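/- **Setting.** Let $X$ be a set and let $\hat\Sigma$ be a simplicial complex over $X$, i.e. a set of finite subsets of $X$ (simplices) that contains $\varnothing$ and is closed under taking subsets. Write $\tau\prec\sigma$ (or $\sigma\succ\tau$) if $\tau\subseteq\sigma$ and $|\sigma\setminus\tau|=1$. Let $m:\hat\Sigma\to(0,\infty)$ be a weight. Put $\Sigma=\hat\Sigma$ if $\sum_{\{v\}\in\hat\Sigma}m(\{v\})<\infty$ and $\Sigma=\hat\Sigma\setminus\{\varnothing\}$ otherwise, and assume that $m$ is locally summable: $\sum_{\sigma\succ\tau}m(\sigma)<\infty$ for all $\tau\in\Sigma$. Let $C(\Sigma)$ be the space of complex-valued functions on $\Sigma$ and $\ell^2=\{\omega\in C(\Sigma):\sum_{\tau\in\Sigma}m(\tau)|\omega(\tau)|^2<\infty\}$. Let $\delta:C(\Sigma)\to C(\Sigma)$ be a coboundary operator, i.e. a linear operator such that $\theta(\tau,\sigma):=\delta 1_\tau(\sigma)\in\{1,-1,0\}$, with $\theta(\tau,\sigma)\neq0$ if and only if $\tau\prec\sigma$, $\ \delta\omega(\sigma)=\sum_{\tau\prec\sigma}\theta(\tau,\sigma)\omega(\tau)$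 for all $\omega\in C(\Sigma)$ and $\sigma\in\Sigma$, and $\delta\delta=0$. The boundary operator $\partial$ has domain $$D(\partial)=\Big\{\omega\in C(\Sigma):\ \sum_{\tau\succ\rho}m(\tau)|\omega(\tau)|<\infty\ \text{ for all }\rho\in\Sigma\Big\}$$ and acts by $$\partial\omega(\rho)=\frac1{m(\rho)}\sum_{\tau\succ\rho}m(\tau)\,\theta(\rho,\tau)\,\omega(\tau),\qquad \rho\in\Sigma;$$ let $D(\partial\partial)=\{\omega\in D(\partial):\partial\omega\in D(\partial)\}$. For $\rho\in\Sigma$, the link $\mathrm{lk}(\rho)$ is the set of vertices $v$ of $\hat\Sigma$ with $v\notin\rho$ and $\{v\}\cup\rho\in\hat\Sigma$, and the link graph $b_\rho:\mathrm{lk}(\rho)\times\mathrm{lk}(\rho)\to[0,\infty)$ is the weighted graph with $b_\rho(v,v')=m(\{v,v'\}\cup\rho)$ if $v\neq v'$ and $\{v,v'\}\cup\rho\in\hat\Sigma$, and $b_\rho(v,v')=0$ otherwise. Two vertices are joined by an edge if $b_\rho(v,v')>0$; connected components are meant with respect to these edges. By local summability $\sum_{v'}b_\rho(v,v')<\infty$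 for all $v$. A connected weighted graph $b$ over a vertex set $V$ is recurrent if the Markov chain $(Y_n)_{n\ge0}$ on $V$ with transition probabilities $\mathbb P(Y_n=y\mid Y_{n-1}=x)=b(x,y)/\sum_z b(x,z)$ (the chain stays put at a vertex without edges, so that a graph consisting of a single vertex is recurrent) satisfies $\mathbb P(Y_k=y\text{ for some }k>0\mid Y_0=x)=1$ for all $x,y\in V$. **Theorem.** Let $\rho\in\Sigma$. Then the following are equivalent: (i) $\partial\partial\omega(\rho)=0$ for all $\omega\in D(\partial\partial)\cap\ell^2$. (ii) All connected components of the graph $b_\rho$ over $\mathrm{lk}(\rho)$ are recurrent. -/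

import Mathlib

open MeasureTheory ProbabilityTheory

/-! ## Weighted graphs and recurrence -/

/-- A weighted graph over a discrete set `V`: a symmetric function `b : V × V → [0, ∞)` with
vanishing diagonal which is locally summable. -/
structure WeightedGraph (V : Type*) where
  b : V → V → ℝ
  nonneg : ∀ x y, 0 ≤ b x y
  symm : ∀ x y, b x y = b y x
  diag : ∀ x, b x x = 0
  summable : ∀ x, Summable (b x)

namespace WeightedGraph

variable {V : Type*} (G : WeightedGraph V)

/-- The underlying combinatorial graph: `x` and `y` are joined by an edge iff `b x y > 0`. -/
def toSimpleGraph : SimpleGraph V where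
  Adj x y := 0 < G.b x y
  symm := ⟨fun x y h => by rw [G.symm y x]; exact h⟩
  loopless := ⟨fun x h => by rw [G.diag x] at h; exact lt_irrefl _ h⟩

/-- The restriction of a weighted graph to a subset of its vertices. -/
def induce (s : Set V) : WeightedGraph s where
  b x y := G.b x y
  nonneg x y := G.nonneg x y
  symm x y := G.symm x y
  diag x := G.diag x
  summable x := (G.summable x).comp_injective Subtype.val_injective

/-- The total weight `∑_z b(x, z)` of the edges at `x`. -/
noncomputable def deg (x : V) : ℝ := ∑' z, G.b x z

open Classical in
/-- One step of the random walk from `x`: `P(Y_n = y | Y_{n-1} = x) = b(x, y) / ∑_z b(x, z)`.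
At a vertex without edges (where this fraction is `0 / 0`) the walk stays put. -/
noncomputable def step (x : V) : PMF V :=
  if h : G.deg x = 0 then PMF.pure x
  else ⟨fun y => ENNReal.ofReal (G.b x y / G.deg x), by
    have hpos : ∀ y, 0 ≤ G.b x y / G.deg x := fun y =>
      div_nonneg (G.nonneg x y) (tsum_nonneg (G.nonneg x))
    have hs : Summable fun y => G.b x y / G.deg x := (G.summable x).div_const _
    have h1 : ∑' y, ENNReal.ofReal (G.b x y / G.deg x) = 1 := by
      rw [← ENNReal.ofReal_tsum_of_nonneg hpos hs, tsum_div_const]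
      exact (congrArg ENNReal.ofReal (div_self h)).trans ENNReal.ofReal_one
    exact h1 ▸ ENNReal.summable.hasSum⟩

/-- The transition kernel of the random walk at time `n`: given the path `(Y_0, …, Y_n)`, the
conditional law of `Y_{n+1}` is `step Y_n`. -/
noncomputable def stepKernel [MeasurableSpace V] [DiscreteMeasurableSpace V] (n : ℕ) :
    Kernel (Π _ : Finset.Iic n, V) V where
  toFun past := (G.step (past ⟨n, Finset.mem_Iic.2 le_rfl⟩)).toMeasure
  measurable' := (Measurable.of_discrete (f := fun z => (G.step z).toMeasure)).comp
    (measurable_pi_apply _)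

instance [MeasurableSpace V] [DiscreteMeasurableSpace V] (n : ℕ) :
    IsMarkovKernel (G.stepKernel n) :=
  ⟨fun past => inferInstanceAs (IsProbabilityMeasure (G.step (past ⟨n, _⟩)).toMeasure)⟩

/-- The law, on the path space `ℕ → V`, of the random walk `(Y_n)` started at `x`, i.e. of the
Markov chain with transition probabilities `step` and `Y_0 = x`. -/
noncomputable def walkLaw [MeasurableSpace V] [DiscreteMeasurableSpace V] (x : V) :
    Measure (ℕ → V) :=
  Kernel.traj (X := fun _ => V) G.stepKernel 0 (fun _ => x)

/-- Recurrence of a (connected) graph: for all `x, y`, the random walk started at `x` almost surely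
visits `y` at some time `k > 0`. Here `V` carries the discrete σ-algebra. -/
def IsRecurrent : Prop :=
  letI : MeasurableSpace V := ⊤
  ∀ x y : V, G.walkLaw x {Y | ∃ k > 0, Y k = y} = 1

end WeightedGraph

/-! ## Weighted simplicial complexes -/

/-- `τ ≺ σ`: `τ` is a face of `σ` (and `σ` a coface of `τ`), i.e. `τ ⊆ σ` and `|σ \ τ| = 1`. -/
def IsFace {X : Type*} [DecidableEq X] (τ σ : Finset X) : Prop :=
  τ ⊆ σ ∧ (σ \ τ).card = 1

/-- A simplicial complex (containing the empty simplex) with a positive weight `m` on its simplices.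
Only the values of `m` on simplices are ever used. -/
structure WeightedComplex (X : Type*) where
  /-- all simplices, including the empty one -/
  faces : Set (Finset X)
  empty_mem : ∅ ∈ faces
  down_closed : ∀ ⦃σ τ : Finset X⦄, σ ∈ faces → τ ⊆ σ → τ ∈ faces
  m : Finset X → ℝ
  m_pos : ∀ σ ∈ faces, 0 < m σ

namespace WeightedComplex

variable {X : Type*} (K : WeightedComplex X)

/-- The vertices of the complex have finite total mass. -/
def FiniteVertexMass : Prop := Summable fun v : {v : X // {v} ∈ K.faces} => K.m {v.1}

/-- The simplices that are kept: the empty simplex is discarded unless the vertices have finite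
total mass. -/
def cells : Set (Finset X) := {σ ∈ K.faces | σ = ∅ → K.FiniteVertexMass}

/-- The kept simplices, as a type. -/
abbrev Cell : Type _ := K.cells

variable [DecidableEq X]

/-- Local summability: the cofaces of every (kept) simplex have finite total mass. -/
def LocallySummable : Prop :=
  ∀ τ : K.Cell, Summable fun σ : {σ : K.Cell // IsFace τ.1 σ.1} => K.m σ.1

/-- A coboundary operator: a linear operator `δ` on the complex functions on the simplices with
`δ 1_τ(σ) ∈ {1, -1, 0}`, with `δ 1_τ(σ) ≠ 0` iff `τ ≺ σ`, with `δ δ = 0`, and acting by the finite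
sums `δω(σ) = ∑_{τ ≺ σ} δ1_τ(σ) ω(τ)`. -/
structure Coboundary where
  op : (K.Cell → ℂ) →ₗ[ℂ] (K.Cell → ℂ)
  sign : ∀ τ σ : K.Cell, op (Pi.single τ 1) σ ∈ ({1, -1, 0} : Set ℂ)
  ne_zero_iff : ∀ τ σ : K.Cell, op (Pi.single τ 1) σ ≠ 0 ↔ IsFace τ.1 σ.1
  apply_eq : ∀ (ω : K.Cell → ℂ) (σ : K.Cell),
    op ω σ = ∑ᶠ τ ∈ {τ : K.Cell | IsFace τ.1 σ.1}, op (Pi.single τ 1) σ * ω τ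
  op_op : ∀ ω : K.Cell → ℂ, op (op ω) = 0

variable {K}

/-- The incidence signs `θ(τ, σ) = δ1_τ(σ)`. -/
def Coboundary.θ (δ : K.Coboundary) (τ σ : K.Cell) : ℂ := δ.op (Pi.single τ 1) σ

/-- The boundary operator `∂ω(ρ) = m(ρ)⁻¹ ∑_{τ ≻ ρ} m(τ) θ(ρ, τ) ω(τ)` (meaningful on its
domain, see `boundaryDomain`). -/
noncomputable def Coboundary.boundary (δ : K.Coboundary) (ω : K.Cell → ℂ) : K.Cell → ℂ := fun ρ =>
  (1 / (K.m ρ : ℂ)) * ∑' τ : {τ : K.Cell // IsFace ρ.1 τ.1}, (K.m τ.1 : ℂ) * δ.θ ρ τ.1 * ω τ.1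

variable (K)

/-- The domain `D(∂)`: all `ω` with `∑_{τ ≻ ρ} m(τ) |ω(τ)| < ∞` for every `ρ`. -/
def boundaryDomain : Set (K.Cell → ℂ) :=
  {ω | ∀ ρ : K.Cell, Summable fun τ : {τ : K.Cell // IsFace ρ.1 τ.1} => K.m τ.1 * ‖ω τ.1‖}

/-- The domain `D(∂∂)`: all `ω ∈ D(∂)` with `∂ω ∈ D(∂)`. -/
def boundaryBoundaryDomain (δ : K.Coboundary) : Set (K.Cell → ℂ) :=
  {ω | ω ∈ K.boundaryDomain ∧ δ.boundary ω ∈ K.boundaryDomain}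

/-- The space `ℓ²` of all `ω` with `∑_τ m(τ) |ω(τ)|² < ∞`. -/
def ell2 : Set (K.Cell → ℂ) := {ω | Summable fun τ : K.Cell => K.m τ * ‖ω τ‖ ^ 2}

/-- The link of `ρ`: all vertices `v` such that `v ∪ ρ` is a simplex and a coface of `ρ`. -/
def link (ρ : K.Cell) : Set X :=
  {v | {v} ∈ K.faces ∧ insert v ρ.1 ∈ K.faces ∧ IsFace ρ.1 (insert v ρ.1)}

open Classical in
/-- The edge weights on the link: `b_ρ(v, v') = m(v v' ρ)` for `v ≠ v'` if `v v' ρ` is a simplex,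
and `0` otherwise. -/
noncomputable def linkWeight (ρ : K.Cell) (v v' : K.link ρ) : ℝ :=
  if v ≠ v' ∧ insert v.1 (insert v'.1 ρ.1) ∈ K.faces then K.m (insert v.1 (insert v'.1 ρ.1)) else 0

variable {K}

theorem not_mem_of_mem_link {ρ : K.Cell} {v : X} (hv : v ∈ K.link ρ) : v ∉ ρ.1 := by
  intro h
  have h2 := hv.2.2.2
  rw [Finset.insert_eq_of_mem h] at h2
  simp at h2

theorem insert_mem_cells {τ : Finset X} {v : X} (h : insert v τ ∈ K.faces) :
    insert v τ ∈ K.cells :=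
  ⟨h, fun h0 => absurd h0 (Finset.insert_ne_empty v τ)⟩

theorem isFace_insert {τ : Finset X} {v : X} (h : v ∉ τ) : IsFace τ (insert v τ) :=
  ⟨Finset.subset_insert v τ, by rw [Finset.insert_sdiff_cancel h]; simp⟩

theorem summable_linkWeight (hK : K.LocallySummable) (ρ : K.Cell) (v : K.link ρ) :
    Summable (K.linkWeight ρ v) := by
  classical
  let τ : K.Cell := ⟨insert v.1 ρ.1, insert_mem_cells v.2.2.1⟩
  let s : Set (K.link ρ) := {v' | v ≠ v' ∧ insert v.1 (insert v'.1 ρ.1) ∈ K.faces}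
  have hs : ∀ w : s, w.1.1 ∉ τ.1 := fun w hw => by
    rcases Finset.mem_insert.1 hw with h | h
    · exact w.2.1 (Subtype.ext h.symm)
    · exact not_mem_of_mem_link w.1.2 h
  let e : s → {σ : K.Cell // IsFace τ.1 σ.1} := fun w =>
    ⟨⟨insert w.1.1 τ.1, insert_mem_cells (by
      have := w.2.2
      rwa [Finset.insert_comm] at this)⟩, isFace_insert (hs w)⟩
  have he : Function.Injective e := fun w w' h => by
    have h1 : insert w.1.1 τ.1 = insert w'.1.1 τ.1 := congrArg (fun x => x.1.1) h
    have h2 : w.1.1 ∈ insert w'.1.1 τ.1 := h1 ▸ Finset.mem_insert_self _ _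
    rcases Finset.mem_insert.1 h2 with h3 | h3
    · exact Subtype.ext (Subtype.ext h3)
    · exact absurd h3 (hs w)
  have h1 : Summable fun w : s => K.m (insert v.1 (insert w.1.1 ρ.1)) := by
    refine ((hK τ).comp_injective he).congr fun w => ?_
    simp only [Function.comp, e, τ]
    rw [Finset.insert_comm]
  have h2 := summable_subtype_iff_indicator.1
    (show Summable ((fun v' : K.link ρ => K.m (insert v.1 (insert v'.1 ρ.1))) ∘ ((↑) : s → _))
      from h1)
  refine h2.congr fun w => ?_
  simp only [linkWeight, Set.indicator_apply, s, Set.mem_ofPred_eq]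

/-- The link graph `b_ρ` over `lk(ρ)`. -/
noncomputable def linkGraph (hK : K.LocallySummable) (ρ : K.Cell) : WeightedGraph (K.link ρ) where
  b := K.linkWeight ρ
  nonneg v v' := by
    unfold linkWeight
    split_ifs with h
    · exact (K.m_pos _ h.2).le
    · exact le_rfl
  symm v v' := by
    unfold linkWeight
    rw [Finset.insert_comm]
    classical exact if_congr (and_congr_left' ne_comm) rfl rfl
  diag v := by simp [linkWeight]
  summable := summable_linkWeight hK ρ

end WeightedComplex

/-! The value `∂∂ω(ρ)` is the total divergence of a flow on the link graph. Put `w(v, v') = θ(ρ, vρ)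
θ(vρ, vv'ρ) ω(vv'ρ)` on edges (`linkFlow`). Evaluating `δδ1_ρ = 0` on `vv'ρ` shows that `w` is
antisymmetric, and its divergence at `v` is `m(vρ) θ(ρ, vρ) ∂ω(vρ)`. Hence `m(ρ) ∂∂ω(ρ)` is the sum
of the divergences over `lk(ρ)`. If `ω ∈ ℓ²`, the flow has finite energy; the condition `∂ω ∈ D(∂)`
at `ρ` says that the divergence is summable.

It remains to see that the components are recurrent exactly when flows of finite energy with
summable divergence have total divergence zero; in the converse, gradient flows suffice.

If a component is recurrent, the Green functions truncated at time `n`, normalised at a base vertex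
and cut off at `1`, converge to `1` while their energies tend to `0`
(`IsRecurrent.exists_tendsto_one`). Summation by parts against them and a Cauchy-Schwarz type bound
make the total divergence vanish (`IsRecurrent.tsum_divergence_eq_zero`).

If a component is not recurrent, its Green function at some `o` is finite, has finite energy, and
its Laplacian is `deg(o) 1_o` (`exists_potential_of_not_isRecurrent`). Its gradient flow comes from
some `ω` (`exists_linkFlow_eq_sub`), which lies in `ℓ²` and in `D(∂∂)`
(`boundary_mem_boundaryDomain`) but has `∂∂ω(ρ) ≠ 0`.

The link between path-space recurrence and Green functions is a last-visit decomposition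
(`survival_add_sum_visit`). -/

theorem PMF.lintegral_toMeasure {α : Type*} [MeasurableSpace α] [DiscreteMeasurableSpace α]
    (p : PMF α) (f : α → ENNReal) : ∫⁻ a, f a ∂p.toMeasure = ∑' a, p a * f a := by
  have h : p.toMeasure = Measure.sum fun a => p a • Measure.dirac a := by
    ext s hs
    rw [p.toMeasure_apply hs, Measure.sum_apply _ hs]
    refine tsum_congr fun a => ?_
    rw [Measure.smul_apply, Measure.dirac_apply' _ hs]
    by_cases ha : a ∈ s <;> simp [ha]
  have hf : Measurable f := Measurable.of_discrete
  rw [h, lintegral_sum_measure]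
  refine tsum_congr fun a => ?_
  rw [lintegral_smul_measure, lintegral_dirac' _ hf, smul_eq_mul]

/-! ### From the walk on path space to survival probabilities -/

namespace WeightedGraph

variable {V : Type*} (G : WeightedGraph V)

/-- The transition operator of the random walk killed when it enters `o`. -/
noncomputable def killed (o : V) (g : V → ENNReal) (x : V) : ENNReal :=
  ∑' y, G.step x y * ({o}ᶜ : Set V).indicator g y

/-- The paths up to time `n` which do not visit `o` at a positive time. -/
def avoiding (o : V) (n : ℕ) : Set (Π _ : Finset.Iic n, V) :=
  {p | ∀ k : Finset.Iic n, 0 < k.1 → p k ≠ o}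

section Walk

variable [MeasurableSpace V] [DiscreteMeasurableSpace V]

instance (x : V) : IsProbabilityMeasure (G.walkLaw x) :=
  inferInstanceAs (IsProbabilityMeasure (Kernel.traj (X := fun _ => V) G.stepKernel 0 fun _ => x))

theorem measurableSet_avoiding (o : V) (n : ℕ) :
    MeasurableSet (avoiding o n) := by
  have : avoiding o n = ⋂ k : Finset.Iic n, ⋂ _ : 0 < k.1, (fun p => p k) ⁻¹' {o}ᶜ := by
    ext p; simp [avoiding]
  rw [this]
  exact MeasurableSet.iInter fun k => MeasurableSet.iInter fun _ =>
    measurable_pi_apply k (measurableSet_singleton o).compl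

/-- The Markov property in integrated form: `F` depends on the path up to time `n`, and the next
position is averaged out by `step`. -/
theorem lintegral_walkLaw_succ (x : V) (n : ℕ) {F : (Π _ : Finset.Iic n, V) → ENNReal}
    (hF : Measurable F) (g : V → ENNReal) :
    ∫⁻ Y, F (Preorder.frestrictLe n Y) * g (Y (n + 1)) ∂G.walkLaw x =
      ∫⁻ Y, F (Preorder.frestrictLe n Y) * ∑' y, G.step (Y n) y * g y ∂G.walkLaw x := by
  have hg : Measurable g := Measurable.of_discrete
  have hm : Measurable fun q : (Π _ : Finset.Iic n, V) × V => F q.1 * g q.2 :=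
    (hF.comp measurable_fst).mul (hg.comp measurable_snd)
  have h1 := Kernel.partialTraj_compProd_eq_map_traj (X := fun _ => V) (κ := G.stepKernel)
    (Nat.zero_le n) (x₀ := fun _ => x)
  have h2 := congrArg (fun μ => ∫⁻ q, F q.1 * g q.2 ∂μ) h1
  rw [Measure.lintegral_compProd hm, lintegral_map hm (by fun_prop),
    ← Kernel.traj_map_frestrictLe_apply, lintegral_map (by
      exact hm.lintegral_kernel_prod_right') (by fun_prop)] at h2
  refine h2.symm.trans (lintegral_congr fun Y => ?_)
  refine (lintegral_const_mul (F (Preorder.frestrictLe n Y)) hg).trans ?_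
  congr 1
  exact PMF.lintegral_toMeasure _ _

theorem lintegral_walkLaw_zero (x : V) (g : V → ENNReal) :
    ∫⁻ Y, g (Y 0) ∂G.walkLaw x = g x := by
  have hg : Measurable g := Measurable.of_discrete
  unfold walkLaw
  rw [Kernel.lintegral_traj (X := fun _ => V) (f := fun Y => g (Y 0)) _
    (hg.comp (measurable_pi_apply 0))]
  simp [Function.updateFinset]

/-- The last step is averaged out first, and its avoidance of `o` is the indicator in `killed`; the
induction therefore needs arbitrary `g`. -/
theorem lintegral_avoiding (o x : V) (n : ℕ) (g : V → ENNReal) :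
    ∫⁻ Y, (avoiding o n).indicator 1 (Preorder.frestrictLe n Y) * g (Y n) ∂G.walkLaw x =
      (G.killed o)^[n] g x := by
  induction n generalizing g with
  | zero =>
    rw [Function.iterate_zero, id, ← G.lintegral_walkLaw_zero x g]
    refine lintegral_congr fun Y => ?_
    rw [Set.indicator_of_mem, Pi.one_apply, one_mul]
    intro k hk
    have := Finset.mem_Iic.1 k.2
    omega
  | succ n ih =>
    rw [Function.iterate_succ_apply, ← ih]
    unfold killed
    rw [← G.lintegral_walkLaw_succ x n
      (measurable_one.indicator (measurableSet_avoiding o n))]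
    refine lintegral_congr fun Y => ?_
    have key : Preorder.frestrictLe (n + 1) Y ∈ avoiding o (n + 1) ↔
        Preorder.frestrictLe n Y ∈ avoiding o n ∧ Y (n + 1) ≠ o := by
      constructor
      · intro h
        refine ⟨fun k hk => h ⟨k.1, Finset.mem_Iic.2 ?_⟩ hk, h ⟨n + 1, by simp⟩ n.succ_pos⟩
        exact (Finset.mem_Iic.1 k.2).trans n.le_succ
      · rintro ⟨h, h'⟩ ⟨k, hk⟩ hk0
        rcases Nat.lt_or_ge n k with hlt | hge
        · obtain rfl : k = n + 1 := le_antisymm (Finset.mem_Iic.1 hk) hlt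
          exact h'
        · exact h ⟨k, Finset.mem_Iic.2 hge⟩ hk0
    by_cases h1 : Preorder.frestrictLe n Y ∈ avoiding o n <;> by_cases h2 : Y (n + 1) = o <;>
      simp [key, h1, h2]

end Walk

/-- The probability that the random walk started at `x` does not visit `o` at the times
`1, …, n`. -/
noncomputable def survival (o : V) (n : ℕ) : V → ENNReal := (G.killed o)^[n] 1

/-- Never visiting `o` is the decreasing intersection of the events of avoiding `o` up to time `n`,
so continuity from above applies. -/
theorem isRecurrent_iff_iInf_survival :
    G.IsRecurrent ↔ ∀ x o, ⨅ n, G.survival o n x = 0 := by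
  let _ : MeasurableSpace V := ⊤
  have key : ∀ x o, G.walkLaw x {Y | ∃ k > 0, Y k = o}ᶜ = ⨅ n, G.survival o n x := by
    intro x o
    have hA : {Y : ℕ → V | ∃ k > 0, Y k = o}ᶜ =
        ⋂ n, Preorder.frestrictLe (π := fun _ => V) n ⁻¹' avoiding o n := by
      ext Y
      simp only [Set.mem_compl_iff, Set.mem_ofPred_eq, Set.mem_iInter, Set.mem_preimage, avoiding,
        not_exists, not_and]
      exact ⟨fun h n k hk => h k.1 hk, fun h k hk => h k ⟨k, by simp⟩ hk⟩
    have hm : ∀ n, MeasurableSet (Preorder.frestrictLe (π := fun _ => V) n ⁻¹' avoiding o n) :=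
      fun n => (measurableSet_avoiding o n).preimage (by fun_prop)
    rw [hA, Antitone.measure_iInter _ (fun n => (hm n).nullMeasurableSet)
      ⟨0, measure_ne_top _ _⟩]
    · refine iInf_congr fun n => ?_
      rw [survival, ← lintegral_avoiding]
      simp only [Pi.one_apply, mul_one]
      rw [← lintegral_indicator_one (hm n)]
      rfl
    · intro n n' hn Y hY k hk
      exact hY ⟨k.1, Finset.mem_Iic.2 ((Finset.mem_Iic.1 k.2).trans hn)⟩ hk
  have hm : ∀ o, MeasurableSet {Y : ℕ → V | ∃ k > 0, Y k = o} := fun o => by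
    have : {Y : ℕ → V | ∃ k > 0, Y k = o} = ⋃ k, ⋃ _ : k > 0, (fun Y => Y k) ⁻¹' {o} := by
      ext; simp
    rw [this]
    exact MeasurableSet.iUnion fun k => MeasurableSet.iUnion fun _ =>
      measurable_pi_apply k (measurableSet_singleton o)
  unfold IsRecurrent
  refine forall₂_congr fun x o => ?_
  rw [← key, prob_compl_eq_zero_iff (hm o)]

end WeightedGraph

/-! ### Visits, Green functions and renewal identities -/

namespace WeightedGraph

variable {V : Type*} (G : WeightedGraph V)

theorem b_le_deg (x y : V) : G.b x y ≤ G.deg x :=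
  (G.summable x).le_tsum y fun z _ => G.nonneg x z

theorem deg_nonneg (x : V) : 0 ≤ G.deg x := tsum_nonneg (G.nonneg x)

theorem tsum_ofReal_b (x : V) : ∑' y, ENNReal.ofReal (G.b x y) = ENNReal.ofReal (G.deg x) :=
  (ENNReal.ofReal_tsum_of_nonneg (G.nonneg x) (G.summable x)).symm

/-- Without division the formula also covers vertices without edges, where both sides vanish. -/
theorem deg_mul_step (x y : V) :
    ENNReal.ofReal (G.deg x) * G.step x y = ENNReal.ofReal (G.b x y) := by
  by_cases h : G.deg x = 0
  · have hb : G.b x y = 0 := le_antisymm (h ▸ G.b_le_deg x y) (G.nonneg x y)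
    simp [h, hb]
  · have h1 : G.step x y = ENNReal.ofReal (G.b x y / G.deg x) :=
      DFunLike.congr_fun (dif_neg h : G.step x = _) y
    rw [h1, ← ENNReal.ofReal_mul (G.deg_nonneg x), mul_div_cancel₀ _ h]

theorem step_ne_zero {x y : V} (h : G.toSimpleGraph.Adj x y) : G.step x y ≠ 0 := by
  intro h0
  have h1 := G.deg_mul_step x y
  rw [h0, mul_zero, eq_comm, ENNReal.ofReal_eq_zero] at h1
  exact h1.not_gt h

/-- The transition operator of the random walk. -/
noncomputable def transition (g : V → ENNReal) (x : V) : ENNReal := ∑' y, G.step x y * g y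

theorem transition_one : G.transition 1 = 1 := by
  ext x
  simp only [transition, Pi.one_apply, mul_one]
  exact (G.step x).tsum_coe

theorem transition_mono {f g : V → ENNReal} (h : f ≤ g) : G.transition f ≤ G.transition g :=
  fun _ => ENNReal.tsum_le_tsum fun y => mul_le_mul_right (h y) _

theorem transition_add (f g : V → ENNReal) :
    G.transition (f + g) = G.transition f + G.transition g := by
  ext x
  simp only [transition, Pi.add_apply, mul_add, ENNReal.tsum_add]

theorem transition_sum {ι : Type*} (s : Finset ι) (f : ι → V → ENNReal) :
    G.transition (∑ i ∈ s, f i) = ∑ i ∈ s, G.transition (f i) := by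
  classical
  induction s using Finset.induction_on with
  | empty => ext x; simp [transition]
  | insert i s hi ih => rw [Finset.sum_insert hi, Finset.sum_insert hi, transition_add, ih]

theorem transition_mul_const (f : V → ENNReal) (a : ENNReal) :
    G.transition (fun x => f x * a) = fun x => G.transition f x * a := by
  ext x
  simp only [transition, ← mul_assoc, ENNReal.tsum_mul_right]

theorem step_mul_le_transition (g : V → ENNReal) (x y : V) :
    G.step x y * g y ≤ G.transition g x :=
  ENNReal.le_tsum (f := fun y => G.step x y * g y) y

theorem deg_mul_transition (g : V → ENNReal) (x : V) :
    ENNReal.ofReal (G.deg x) * G.transition g x = ∑' y, ENNReal.ofReal (G.b x y) * g y := by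
  rw [transition, ← ENNReal.tsum_mul_left]
  exact tsum_congr fun y => by rw [← mul_assoc, deg_mul_step]

/-- Symmetry of `b` makes `deg` an invariant measure of the walk. -/
theorem tsum_deg_mul_transition (g : V → ENNReal) :
    ∑' x, ENNReal.ofReal (G.deg x) * G.transition g x = ∑' x, ENNReal.ofReal (G.deg x) * g x := by
  simp_rw [deg_mul_transition]
  rw [ENNReal.tsum_comm]
  refine tsum_congr fun y => ?_
  rw [ENNReal.tsum_mul_right, ← tsum_ofReal_b]
  simp_rw [G.symm y]

/-- The probability that the random walk is at `o` after `k` steps. -/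
noncomputable def visit (o : V) (k : ℕ) : V → ENNReal :=
  G.transition^[k] (({o} : Set V).indicator 1)

theorem visit_zero (o : V) : G.visit o 0 = ({o} : Set V).indicator 1 := rfl

theorem visit_succ (o : V) (k : ℕ) : G.visit o (k + 1) = G.transition (G.visit o k) :=
  Function.iterate_succ_apply' _ _ _

theorem visit_le_one (o : V) (k : ℕ) : G.visit o k ≤ 1 := by
  induction k with
  | zero => rw [visit_zero]; exact Set.indicator_le_self' fun _ _ => zero_le_one
  | succ k ih => rw [visit_succ]; exact (G.transition_mono ih).trans_eq G.transition_one

theorem tsum_deg_mul_visit (o : V) (k : ℕ) :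
    ∑' x, ENNReal.ofReal (G.deg x) * G.visit o k x = ENNReal.ofReal (G.deg o) := by
  induction k with
  | zero =>
    rw [visit_zero, tsum_eq_single o fun x hx => by simp [hx]]
    simp
  | succ k ih => rw [visit_succ, tsum_deg_mul_transition, ih]

/-- The expected number of visits to `o` before time `n`. -/
noncomputable def green (o : V) (n : ℕ) : V → ENNReal := ∑ k ∈ Finset.range n, G.visit o k

theorem green_mono (o : V) : Monotone (G.green o) := fun _ _ h =>
  Finset.sum_le_sum_of_subset (Finset.range_subset_range.2 h)

theorem green_succ (o : V) (n : ℕ) :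
    G.green o (n + 1) = ({o} : Set V).indicator 1 + G.transition (G.green o n) := by
  rw [green, Finset.sum_range_succ', green, transition_sum, add_comm, visit_zero]
  simp_rw [visit_succ]

theorem green_le (o : V) (n : ℕ) (x : V) : G.green o n x ≤ n := by
  rw [green, Finset.sum_apply]
  refine (Finset.sum_le_card_nsmul _ _ 1 fun k _ => G.visit_le_one o k x).trans ?_
  simp

theorem tsum_deg_mul_green (o : V) (n : ℕ) :
    ∑' x, ENNReal.ofReal (G.deg x) * G.green o n x = n * ENNReal.ofReal (G.deg o) := by
  simp_rw [green, Finset.sum_apply, Finset.mul_sum]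
  rw [Summable.tsum_finsetSum fun _ _ => ENNReal.summable]
  simp [tsum_deg_mul_visit]

theorem killed_add_eq_transition (o : V) (g : V → ENNReal) (x : V) :
    G.killed o g x + G.transition (({o} : Set V).indicator 1) x * g o = G.transition g x := by
  have h : ∀ y, g y = ({o}ᶜ : Set V).indicator g y + ({o} : Set V).indicator 1 y * g o := fun y => by
    by_cases hy : y = o <;> simp [hy]
  rw [killed, transition, transition, ← ENNReal.tsum_mul_right, ← ENNReal.tsum_add]
  exact tsum_congr fun y => by rw [mul_assoc, ← mul_add, ← h]

theorem survival_zero (o : V) : G.survival o 0 = 1 := rfl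

theorem survival_succ (o : V) (n : ℕ) : G.survival o (n + 1) = G.killed o (G.survival o n) :=
  Function.iterate_succ_apply' _ _ _

theorem killed_mono (o : V) {f g : V → ENNReal} (h : f ≤ g) : G.killed o f ≤ G.killed o g :=
  fun _ => ENNReal.tsum_le_tsum fun y => mul_le_mul_right
    (Set.indicator_le_indicator (h y)) _

theorem survival_antitone (o : V) : Antitone (G.survival o) := by
  refine antitone_nat_of_succ_le fun n => ?_
  induction n with
  | zero =>
    rw [survival_succ, survival_zero]
    refine fun x => (le_self_add.trans_eq (G.killed_add_eq_transition o 1 x)).trans_eq ?_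
    rw [transition_one]
  | succ n ih => 
    rw [survival_succ _ _ (n + 1)]
    nth_rw 2 [survival_succ]
    exact G.killed_mono o ih

theorem survival_le_one (o : V) (n : ℕ) : G.survival o n ≤ 1 :=
  G.survival_antitone o (Nat.zero_le n)

/-- Decomposition according to the last visit to `o` at the times `1, …, n`. -/
theorem survival_add_sum_visit (o : V) (n : ℕ) (x : V) :
    G.survival o n x +
      ∑ k ∈ Finset.range n, G.visit o (k + 1) x * G.survival o (n - (k + 1)) o = 1 := by
  induction n generalizing x with
  | zero => simp [survival_zero]
  | succ n ih =>
    have h : G.survival o n + ∑ k ∈ Finset.range n,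
        (fun x => G.visit o (k + 1) x * G.survival o (n - (k + 1)) o) = 1 := by
      ext x
      rw [Pi.add_apply, Finset.sum_apply, Pi.one_apply, ih]
    have h1 := congrFun (congrArg G.transition h) x
    rw [transition_add, transition_sum, transition_one, Pi.add_apply, Finset.sum_apply,
      ← killed_add_eq_transition G o, ← survival_succ] at h1
    simp_rw [transition_mul_const, ← visit_succ] at h1
    rw [← visit_zero, ← visit_succ, Pi.one_apply, add_assoc, add_comm (_ * _)] at h1
    rw [Finset.sum_range_succ', ← h1]
    simp only [Nat.add_sub_add_right, Nat.add_sub_cancel, zero_add]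

theorem sum_visit_mul_survival (o : V) (n : ℕ) :
    ∑ k ∈ Finset.range (n + 1), G.visit o k o * G.survival o (n - k) o = 1 := by
  rw [Finset.sum_range_succ', ← G.survival_add_sum_visit o n o, visit_zero, add_comm]
  simp

/-- A positive probability of never returning to `o` forces a finite expected number of visits:
bound each survival factor in the renewal identity below by its infimum. -/
theorem tsum_visit_mul_iInf_survival_le (o : V) :
    (∑' k, G.visit o k o) * ⨅ n, G.survival o n o ≤ 1 := by
  rw [← ENNReal.tsum_mul_right, ENNReal.tsum_eq_iSup_nat]
  refine iSup_le fun n => ?_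
  refine (Finset.sum_le_sum_of_subset (Finset.range_subset_range.2 n.le_succ)).trans ?_
  rw [← G.sum_visit_mul_survival o n]
  exact Finset.sum_le_sum fun k _ => mul_le_mul_right (iInf_le _ _) _

theorem tsum_visit_eq_top {o : V} (h : ⨅ n, G.survival o n o = 0) :
    ∑' k, G.visit o k o = ⊤ := by
  by_contra hfin
  have htail := ENNReal.tendsto_sum_nat_add (fun k => G.visit o k o) hfin
  -- The renewal identity at time `N + M` is cut at `N`. The later terms are bounded by the tail of
  -- the visit series, the first `N` terms by `N` times the survival probability at time `M`. Both
  -- are below `1/2`, so they cannot add up to `1`.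
  obtain ⟨N, hN⟩ := (htail.eventually (gt_mem_nhds (show (0 : ENNReal) < 2⁻¹ by simp))).exists
  have hq : ⨅ n, (N : ENNReal) * G.survival o n o < 2⁻¹ := by
    rw [← ENNReal.mul_iInf fun h => absurd h (ENNReal.natCast_ne_top N), h]
    simp
  obtain ⟨M, hM⟩ := iInf_lt_iff.1 hq
  have h1 := G.sum_visit_mul_survival o (N + M)
  rw [add_assoc, Finset.sum_range_add] at h1
  refine h1.not_lt ((ENNReal.add_lt_add (lt_of_le_of_lt ?_ hM) (lt_of_le_of_lt ?_ hN)).trans_eq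
    ENNReal.inv_two_add_inv_two)
  · rw [← nsmul_eq_mul, ← Finset.card_range N, ← Finset.sum_const, Finset.card_range]
    refine Finset.sum_le_sum fun k hk => ?_
    refine (mul_le_mul' (G.visit_le_one o k o) (G.survival_antitone o ?_ o)).trans_eq (one_mul _)
    have := Finset.mem_range.1 hk
    omega
  · refine le_trans (Finset.sum_le_sum fun k _ => ?_) (ENNReal.sum_le_tsum (Finset.range (M + 1)))
    rw [add_comm k N]
    exact mul_le_of_le_one_right' (G.survival_le_one o _ o)

end WeightedGraph

/-! ### Energy estimates for Green functions -/

namespace WeightedGraph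

variable {V : Type*} (G : WeightedGraph V)

theorem propagate_of_preconnected {V : Type*} {H : SimpleGraph V} (hH : H.Preconnected)
    {p : V → Prop} (hp : ∀ x y, H.Adj x y → p x → p y) {x : V} (hx : p x) (y : V) : p y := by
  obtain ⟨w⟩ := hH x y
  induction w with
  | nil => exact hx
  | cons h _ ih => exact ih (hp _ _ h hx)

/-- The energy of a function, with values in `[0, ∞]`: the sum runs over ordered pairs. -/
noncomputable def eenergy (f : V → ENNReal) : ENNReal :=
  ∑' p : V × V, ENNReal.ofReal (G.b p.1 p.2 * ((f p.1).toReal - (f p.2).toReal) ^ 2)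

/-- Green's formula, obtained by expanding `(f x - f y)²` and using the symmetry of `b`. The mixed
term stays on the left to avoid subtraction in `[0, ∞]`. -/
theorem eenergy_add_two_mul {f : V → ENNReal} (hf : ∀ x, f x ≠ ⊤) :
    G.eenergy f + 2 * ∑' x, ENNReal.ofReal (G.deg x) * (f x * G.transition f x) =
      2 * ∑' x, ENNReal.ofReal (G.deg x) * f x ^ 2 := by
  have h1 : ∑' x, ENNReal.ofReal (G.deg x) * (f x * G.transition f x) =
      ∑' p : V × V, ENNReal.ofReal (G.b p.1 p.2) * (f p.1 * f p.2) := by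
    rw [ENNReal.tsum_prod']
    refine tsum_congr fun x => ?_
    rw [mul_left_comm, deg_mul_transition, ← ENNReal.tsum_mul_left]
    exact tsum_congr fun y => mul_left_comm _ _ _
  have h2 : ∑' x, ENNReal.ofReal (G.deg x) * f x ^ 2 =
      ∑' p : V × V, ENNReal.ofReal (G.b p.1 p.2) * f p.1 ^ 2 := by
    rw [ENNReal.tsum_prod']
    refine tsum_congr fun x => ?_
    rw [← tsum_ofReal_b, ← ENNReal.tsum_mul_right]
  have h3 : ∑' x, ENNReal.ofReal (G.deg x) * f x ^ 2 =
      ∑' p : V × V, ENNReal.ofReal (G.b p.1 p.2) * f p.2 ^ 2 := by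
    rw [h2, ← (Equiv.prodComm V V).tsum_eq]
    refine tsum_congr fun p => ?_
    simp only [Equiv.prodComm_apply, Prod.fst_swap, Prod.snd_swap]
    rw [G.symm]
  rw [two_mul (∑' x, ENNReal.ofReal (G.deg x) * f x ^ 2)]
  nth_rw 1 [h2]
  rw [h3, h1, eenergy, ← ENNReal.tsum_mul_left, ← ENNReal.tsum_add, ← ENNReal.tsum_add]
  refine tsum_congr fun p => ?_
  rw [ENNReal.ofReal_mul (G.nonneg _ _)]
  have ha := ENNReal.ofReal_toReal (hf p.1)
  have hb := ENNReal.ofReal_toReal (hf p.2)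
  have ha0 : 0 ≤ (f p.1).toReal := ENNReal.toReal_nonneg
  have hb0 : 0 ≤ (f p.2).toReal := ENNReal.toReal_nonneg
  generalize (f p.1).toReal = a at ha ha0 ⊢
  generalize (f p.2).toReal = b at hb hb0 ⊢
  rw [← ha, ← hb, mul_left_comm 2, ← mul_add, ← mul_add]
  congr 1
  rw [← ENNReal.ofReal_mul ha0, show (2 : ENNReal) = ENNReal.ofReal 2 by simp,
    ← ENNReal.ofReal_mul zero_le_two,
    ← ENNReal.ofReal_add (sq_nonneg _) (by positivity), ← ENNReal.ofReal_pow ha0,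
    ← ENNReal.ofReal_pow hb0, ← ENNReal.ofReal_add (sq_nonneg _) (sq_nonneg _)]
  congr 1
  ring

theorem green_ne_top (o : V) (n : ℕ) (x : V) : G.green o n x ≠ ⊤ :=
  ne_top_of_le_ne_top (ENNReal.natCast_ne_top n) (G.green_le o n x)

/-- Since `green` increases in `n`, its recursion gives `f ≤ 1_o + Pf` for `f = green o n` and the
transition operator `P`. Pairing with `f` and inserting this into Green's formula gives the bound;
truncation at `n` keeps the cancelled term finite. -/
theorem eenergy_green_le (o : V) (n : ℕ) :
    G.eenergy (G.green o n) ≤ 2 * (ENNReal.ofReal (G.deg o) * G.green o n o) := by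
  set f := G.green o n with hf
  have h := G.eenergy_add_two_mul (G.green_ne_top o n)
  rw [← hf] at h
  set A := ∑' x, ENNReal.ofReal (G.deg x) * f x ^ 2
  set B := ∑' x, ENNReal.ofReal (G.deg x) * (f x * G.transition f x)
  have hA : A ≠ ⊤ := by
    refine ne_top_of_le_ne_top (b := n * ∑' x, ENNReal.ofReal (G.deg x) * f x) ?_ ?_
    · rw [hf, tsum_deg_mul_green]
      exact ENNReal.mul_ne_top (ENNReal.natCast_ne_top n)
        (ENNReal.mul_ne_top (ENNReal.natCast_ne_top n) ENNReal.ofReal_ne_top)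
    · rw [← ENNReal.tsum_mul_left]
      refine ENNReal.tsum_le_tsum fun x => ?_
      rw [sq, ← mul_assoc, mul_comm _ (f x)]
      exact mul_le_mul_left (G.green_le o n x) _
  have hB : 2 * B ≠ ⊤ :=
    ne_top_of_le_ne_top (ENNReal.mul_ne_top ENNReal.ofNat_ne_top hA) (h ▸ le_add_self)
  have hAB : A ≤ ENNReal.ofReal (G.deg o) * f o + B := by
    have h0 : ENNReal.ofReal (G.deg o) * f o =
        ∑' x, ENNReal.ofReal (G.deg x) * (f x * ({o} : Set V).indicator 1 x) := by
      rw [tsum_eq_single o fun x hx => by simp [hx]]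
      simp
    rw [h0, ← ENNReal.tsum_add]
    refine ENNReal.tsum_le_tsum fun x => ?_
    rw [← mul_add, ← mul_add, sq]
    refine mul_le_mul_right (mul_le_mul_right ?_ _) _
    have := G.green_mono o n.le_succ x
    rwa [green_succ] at this
  refine (ENNReal.add_le_add_iff_right hB).1 ?_
  rw [h, ← mul_add]
  exact mul_le_mul_right hAB _

theorem summable_of_tsum_ofReal_ne_top {ι : Type*} {f : ι → ℝ} (hf : ∀ i, 0 ≤ f i)
    (h : ∑' i, ENNReal.ofReal (f i) ≠ ⊤) : Summable f :=
  (ENNReal.summable_toReal h).congr fun i => ENNReal.toReal_ofReal (hf i)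

/-- On a connected recurrent graph the constant function `1` is a limit of functions of small
energy which are summable with respect to the total edge weight. -/
theorem IsRecurrent.exists_tendsto_one (hG : G.IsRecurrent) (hc : G.toSimpleGraph.Preconnected) :
    ∃ e : ℕ → V → ℝ, (∀ n x, 0 ≤ e n x ∧ e n x ≤ 1) ∧
      (∀ n, Summable fun x => G.deg x * e n x) ∧
      (∀ n, Summable fun p : V × V => G.b p.1 p.2 * (e n p.1 - e n p.2) ^ 2) ∧
      Filter.Tendsto (fun n => ∑' p : V × V, G.b p.1 p.2 * (e n p.1 - e n p.2) ^ 2)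
        Filter.atTop (nhds 0) ∧
      ∀ x, Filter.Tendsto (fun n => e n x) Filter.atTop (nhds 1) := by
  rcases isEmpty_or_nonempty V with hV | ⟨⟨o⟩⟩
  · exact ⟨0, by simp, fun n => summable_empty, fun n => summable_empty, by simp, by simp⟩
  have htop := G.tsum_visit_eq_top (G.isRecurrent_iff_iInf_survival.1 hG o o)
  set g : ℕ → V → ℝ := fun n x => (G.green o n x).toReal with hg
  have hg0 : ∀ n x, 0 ≤ g n x := fun n x => ENNReal.toReal_nonneg
  have hglim : Filter.Tendsto (fun n => g (n + 1) o) Filter.atTop Filter.atTop := by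
    have h1 : Filter.Tendsto (fun n => G.green o n o) Filter.atTop (nhds ⊤) := by
      rw [← htop]
      simpa [green, Finset.sum_apply] using ENNReal.tendsto_nat_tsum fun k => G.visit o k o
    have h2 : Filter.Tendsto (fun n => g n o) Filter.atTop Filter.atTop := by
      have : (fun n => G.green o n o) = fun n => ENNReal.ofReal (g n o) := by
        ext n
        rw [ENNReal.ofReal_toReal (G.green_ne_top o n o)]
      rw [this] at h1
      exact ENNReal.tendsto_ofReal_nhds_top.1 h1
    exact h2.comp (Filter.tendsto_add_atTop_nat 1)
  have hpos : ∀ n, 0 < g (n + 1) o := fun n => by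
    refine ENNReal.toReal_pos ?_ (G.green_ne_top o _ o)
    rw [green_succ]
    simp
  have hE : ∀ n, Summable fun p : V × V => G.b p.1 p.2 * (g n p.1 - g n p.2) ^ 2 := fun n => by
    refine summable_of_tsum_ofReal_ne_top (fun p => mul_nonneg (G.nonneg _ _) (sq_nonneg _))
      (ne_top_of_le_ne_top ?_ (G.eenergy_green_le o n))
    exact ENNReal.mul_ne_top ENNReal.ofNat_ne_top
      (ENNReal.mul_ne_top ENNReal.ofReal_ne_top (G.green_ne_top o n o))
  have hE' : ∀ n, ∑' p : V × V, G.b p.1 p.2 * (g n p.1 - g n p.2) ^ 2 ≤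
      2 * (G.deg o * g n o) := fun n => by
    have h1 := G.eenergy_green_le o n
    rw [eenergy, ← ENNReal.ofReal_tsum_of_nonneg
      (fun p => mul_nonneg (G.nonneg _ _) (sq_nonneg _)) (hE n),
      ← ENNReal.ofReal_toReal (G.green_ne_top o n o), ← ENNReal.ofReal_mul (G.deg_nonneg o),
      show (2 : ENNReal) = ENNReal.ofReal 2 by simp, ← ENNReal.ofReal_mul zero_le_two] at h1
    exact (ENNReal.ofReal_le_ofReal_iff (mul_nonneg zero_le_two
      (mul_nonneg (G.deg_nonneg o) (hg0 n o)))).1 h1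
  -- Cutting off at `1` does not increase energy, so the energy of `e n` is at most `2 deg(o) / g (n
  -- + 1) o`, which tends to `0` because the expected number of visits diverges. The shift to `n +
  -- 1` makes the denominator positive.
  set e : ℕ → V → ℝ := fun n x => min 1 (g (n + 1) x / g (n + 1) o) with he
  have hle : ∀ n (p : V × V), G.b p.1 p.2 * (e n p.1 - e n p.2) ^ 2 ≤
      (g (n + 1) o ^ 2)⁻¹ * (G.b p.1 p.2 * (g (n + 1) p.1 - g (n + 1) p.2) ^ 2) := fun n p => by
    have h1 : |e n p.1 - e n p.2| ≤ |g (n + 1) p.1 / g (n + 1) o - g (n + 1) p.2 / g (n + 1) o| := by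
      refine (abs_min_sub_min_le_max _ _ _ _).trans ?_
      simp
    rw [mul_left_comm]
    refine mul_le_mul_of_nonneg_left ((sq_le_sq.2 h1).trans_eq ?_) (G.nonneg _ _)
    rw [← sub_div, div_pow, div_eq_inv_mul]
  have hsum : ∀ n, Summable fun p : V × V => G.b p.1 p.2 * (e n p.1 - e n p.2) ^ 2 := fun n =>
    Summable.of_nonneg_of_le (fun p => mul_nonneg (G.nonneg _ _) (sq_nonneg _)) (hle n)
      ((hE (n + 1)).mul_left _)
  have hlim : Filter.Tendsto (fun n => ∑' p : V × V, G.b p.1 p.2 * (e n p.1 - e n p.2) ^ 2)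
      Filter.atTop (nhds 0) := by
    have h1 : Filter.Tendsto (fun n => 2 * G.deg o / g (n + 1) o) Filter.atTop (nhds 0) :=
      hglim.const_div_atTop _
    refine squeeze_zero (fun n => tsum_nonneg fun p => mul_nonneg (G.nonneg _ _) (sq_nonneg _))
      (fun n => ?_) h1
    refine ((hsum n).tsum_le_tsum (hle n) ((hE (n + 1)).mul_left _)).trans ?_
    rw [tsum_mul_left]
    refine (mul_le_mul_of_nonneg_left (hE' (n + 1)) (by positivity)).trans_eq ?_
    have := (hpos n).ne'
    field_simp
  have he0 : ∀ n x, 0 ≤ e n x := fun n x =>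
    le_min zero_le_one (div_nonneg (hg0 _ _) (hg0 _ _))
  refine ⟨e, fun n x => ⟨he0 n x, min_le_left _ _⟩, fun n => ?_, hsum, hlim, ?_⟩
  · have h1 : Summable fun x => G.deg x * g (n + 1) x := by
      have h2 : ∑' x, ENNReal.ofReal (G.deg x) * G.green o (n + 1) x ≠ ⊤ := by
        rw [tsum_deg_mul_green]
        exact ENNReal.mul_ne_top (ENNReal.natCast_ne_top _) ENNReal.ofReal_ne_top
      refine (ENNReal.summable_toReal h2).congr fun x => ?_
      rw [ENNReal.toReal_mul, ENNReal.toReal_ofReal (G.deg_nonneg x)]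
    refine Summable.of_nonneg_of_le (fun x => mul_nonneg (G.deg_nonneg x) (he0 n x)) (fun x => ?_)
      (h1.mul_right (g (n + 1) o)⁻¹)
    rw [mul_assoc]
    exact mul_le_mul_of_nonneg_left (min_le_right _ _) (G.deg_nonneg x)
  -- At `o` the value is always `1`. Vanishing energy forces the difference across each edge to `0`,
  -- so the limit spreads by connectedness.
  · refine propagate_of_preconnected hc (p := fun x =>
      Filter.Tendsto (fun n => e n x) Filter.atTop (nhds 1)) (fun x y hxy hx => ?_) (x := o) ?_
    · have hb : 0 < G.b x y := hxy
      have h1 : Filter.Tendsto (fun n => (e n x - e n y) ^ 2) Filter.atTop (nhds 0) := by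
        have h2 := hlim.const_mul (G.b x y)⁻¹
        rw [mul_zero] at h2
        refine squeeze_zero (fun n => sq_nonneg _) (fun n => ?_) h2
        rw [inv_mul_eq_div, le_div_iff₀' hb]
        exact (hsum n).le_tsum (x, y) fun p _ => mul_nonneg (G.nonneg _ _) (sq_nonneg _)
      have h2 : Filter.Tendsto (fun n => e n x - e n y) Filter.atTop (nhds 0) := by
        have h3 := h1.sqrt
        simp only [Real.sqrt_sq_eq_abs, Real.sqrt_zero] at h3
        exact (tendsto_zero_iff_abs_tendsto_zero _).2 h3
      simpa using hx.sub h2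
    · refine tendsto_const_nhds.congr fun n => ?_
      rw [he]
      simp [div_self (hpos n).ne']

/-- On a connected graph which is not recurrent there is a function of finite energy whose
Laplacian is a nonzero multiple of the indicator function of a vertex. -/
theorem exists_potential_of_not_isRecurrent (hG : ¬G.IsRecurrent)
    (hc : G.toSimpleGraph.Preconnected) :
    ∃ (f : V → ℝ) (o : V), 0 < G.deg o ∧
      (Summable fun p : V × V => G.b p.1 p.2 * (f p.1 - f p.2) ^ 2) ∧
      ∀ x, ∑' y, G.b x y * (f x - f y) = ({o} : Set V).indicator G.deg x := by
  rw [isRecurrent_iff_iInf_survival] at hG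
  push Not at hG
  obtain ⟨x₀, o, hx₀⟩ := hG
  -- If return to `o` were certain, then so would be reaching `o` from every vertex accessible from
  -- `o`, hence from `x₀`.
  have hq : ⨅ n, G.survival o n o ≠ 0 := by
    intro h0
    refine hx₀ (propagate_of_preconnected hc (p := fun x => ⨅ n, G.survival o n x = 0)
      (fun x y hxy hx => ?_) h0 x₀)
    by_cases hy : y = o
    · rw [hy, h0]
    have hp := G.step_ne_zero hxy
    have h1 : G.step x y * ⨅ n, G.survival o n y ≤ ⨅ n, G.survival o n x := by
      refine le_iInf fun n => ?_
      refine (mul_le_mul_right (iInf_le _ n) _).trans ?_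
      refine le_trans ?_ (G.survival_antitone o n.le_succ x)
      rw [Nat.succ_eq_add_one, survival_succ]
      refine le_trans ?_ (ENNReal.le_tsum (f := fun y => G.step x y * _) y)
      simp [hy]
    rw [hx, nonpos_iff_eq_zero, mul_eq_zero] at h1
    exact h1.resolve_left hp
  -- The full Green function. It is finite at `o` by the renewal bound, and finiteness spreads along
  -- edges because `g x ≥ step x y * g y`.
  set g : V → ENNReal := fun x => ∑' k, G.visit o k x with hg
  have hgeq : ∀ x, g x = ({o} : Set V).indicator 1 x + G.transition g x := fun x => by
    rw [hg]
    simp only [transition]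
    rw [tsum_eq_zero_add' ENNReal.summable, visit_zero]
    simp_rw [← ENNReal.tsum_mul_left]
    rw [ENNReal.tsum_comm]
    simp_rw [visit_succ]
    rfl
  have hgo : g o ≠ ⊤ := fun h => by
    have h1 := G.tsum_visit_mul_iInf_survival_le o
    rw [show ∑' k, G.visit o k o = ⊤ from h, ENNReal.top_mul hq] at h1
    simp at h1
  have hgfin : ∀ x, g x ≠ ⊤ := by
    refine propagate_of_preconnected hc (p := fun x => g x ≠ ⊤) (fun x y hxy hx hy => hx ?_) hgo
    rw [hgeq, ← top_le_iff]
    refine le_trans ?_ le_add_self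
    refine le_trans ?_ (G.step_mul_le_transition g x y)
    rw [hy, ENNReal.mul_top (G.step_ne_zero hxy)]
  refine ⟨fun x => (g x).toReal, o, lt_of_le_of_ne (G.deg_nonneg o) fun h => hq ?_, ?_, fun x => ?_⟩
  -- If `deg o = 0`, the walk stays at `o` and so visits it at time `1`.
  · refine le_antisymm ((iInf_le _ 1).trans_eq ?_) zero_le
    have hstep : G.step o = PMF.pure o := dif_pos h.symm
    rw [G.survival_succ o 0, killed, hstep, ENNReal.tsum_eq_zero]
    intro y
    by_cases hy : y = o <;> simp [hy]
  -- A Fatou argument: each finite partial energy is a limit of those of the truncated Green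
  -- functions, which are uniformly bounded by `c`.
  · refine summable_of_sum_le (c := 2 * (G.deg o * (g o).toReal))
      (fun p => mul_nonneg (G.nonneg _ _) (sq_nonneg _)) fun s => ?_
    have hlim : ∀ x, Filter.Tendsto (fun n => (G.green o n x).toReal) Filter.atTop
        (nhds (g x).toReal) := fun x => by
      refine (ENNReal.tendsto_toReal (hgfin x)).comp ?_
      simpa [green, Finset.sum_apply] using ENNReal.tendsto_nat_tsum fun k => G.visit o k x
    refine le_of_tendsto (tendsto_finsetSum s fun p _ =>
      (((hlim p.1).sub (hlim p.2)).pow 2).const_mul (G.b p.1 p.2))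
      (Filter.Eventually.of_forall fun n => ?_)
    rw [← ENNReal.ofReal_le_ofReal_iff (mul_nonneg zero_le_two
      (mul_nonneg (G.deg_nonneg o) ENNReal.toReal_nonneg)), ENNReal.ofReal_sum_of_nonneg
      fun p _ => mul_nonneg (G.nonneg _ _) (sq_nonneg _)]
    refine ((ENNReal.sum_le_tsum s).trans (G.eenergy_green_le o n)).trans ?_
    rw [ENNReal.ofReal_mul zero_le_two, ENNReal.ofReal_mul (G.deg_nonneg o),
      ENNReal.ofReal_toReal hgo, ENNReal.ofReal_ofNat]
    refine mul_le_mul_right (mul_le_mul_right ?_ _) _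
    rw [green, Finset.sum_apply]
    exact ENNReal.sum_le_tsum _
  · have h1 := congrArg (ENNReal.ofReal (G.deg x) * ·) (hgeq x)
    simp only [mul_add, deg_mul_transition] at h1
    have hfin : ∑' y, ENNReal.ofReal (G.b x y) * g y ≠ ⊤ :=
      ne_top_of_le_ne_top (ENNReal.mul_ne_top ENNReal.ofReal_ne_top (hgfin x))
        (h1 ▸ le_add_self)
    have hfin' : ENNReal.ofReal (G.deg x) * ({o} : Set V).indicator 1 x ≠ ⊤ :=
      ne_top_of_le_ne_top (ENNReal.mul_ne_top ENNReal.ofReal_ne_top (hgfin x))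
        (h1 ▸ le_self_add)
    have hs : Summable fun y => G.b x y * (g y).toReal :=
      (ENNReal.summable_toReal hfin).congr fun y => by
        rw [ENNReal.toReal_mul, ENNReal.toReal_ofReal (G.nonneg x y)]
    have h2 := congrArg ENNReal.toReal h1
    rw [ENNReal.toReal_add hfin' hfin, ENNReal.tsum_toReal_eq fun y =>
      ENNReal.mul_ne_top ENNReal.ofReal_ne_top (hgfin y)] at h2
    simp only [ENNReal.toReal_mul, ENNReal.toReal_ofReal (G.nonneg _ _),
      ENNReal.toReal_ofReal (G.deg_nonneg _)] at h2
    simp only [mul_sub]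
    rw [((G.summable x).mul_right _).tsum_sub hs, tsum_mul_right, ← deg, h2,
      add_sub_cancel_right]
    by_cases hx : x = o <;> simp [hx]

end WeightedGraph

/-! ### Flows of finite energy and their total divergence -/

namespace WeightedGraph

variable {V : Type*} (G : WeightedGraph V)

/-- Young's inequality with a free parameter `t`, which takes the place of Cauchy-Schwarz below. -/
theorem norm_mul_mul_le {b : ℝ} (hb : 0 ≤ b) (u : ℝ) (w : ℂ) {t : ℝ} (ht : 0 < t) :
    ‖(u : ℂ) * ((b : ℂ) * w)‖ ≤ t * (b * ‖w‖ ^ 2) + t⁻¹ * (b * u ^ 2) := by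
  rw [norm_mul, norm_mul, Complex.norm_real, Complex.norm_real, Real.norm_eq_abs,
    Real.norm_of_nonneg hb]
  have h : 2 * (|u| * ‖w‖) ≤ t * ‖w‖ ^ 2 + t⁻¹ * u ^ 2 := by
    rw [← sq_abs u]
    have h1 := mul_nonneg ht.le (sq_nonneg (‖w‖ - t⁻¹ * |u|))
    have h2 : t * (‖w‖ - t⁻¹ * |u|) ^ 2 = t * ‖w‖ ^ 2 + t⁻¹ * |u| ^ 2 - 2 * (|u| * ‖w‖) := by
      field_simp
      ring
    linarith
  have h3 : 0 ≤ |u| * ‖w‖ := by positivity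
  calc |u| * (b * ‖w‖) = b * (|u| * ‖w‖) := by ring
    _ ≤ b * (t * ‖w‖ ^ 2 + t⁻¹ * u ^ 2) := mul_le_mul_of_nonneg_left (by linarith) hb
    _ = _ := by ring

/-- The divergence of the flow with intensity `w` per edge weight. -/
noncomputable def divergence (w : V → V → ℂ) (x : V) : ℂ := ∑' y, (G.b x y : ℂ) * w x y

variable {G}

/-- Summation by parts against a bounded function of finite total mass. -/
theorem two_mul_tsum_mul_divergence {w : V → V → ℂ} (hw : ∀ x y, w y x = -w x y)
    (hE : Summable fun p : V × V => G.b p.1 p.2 * ‖w p.1 p.2‖ ^ 2) {e : V → ℝ}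
    (he : ∀ x, 0 ≤ e x ∧ e x ≤ 1) (hs : Summable fun x => G.deg x * e x) :
    2 * ∑' x, (e x : ℂ) * G.divergence w x =
      ∑' p : V × V, ((e p.1 - e p.2 : ℝ) : ℂ) * ((G.b p.1 p.2 : ℂ) * w p.1 p.2) := by
  have hbe : Summable fun p : V × V => G.b p.1 p.2 * e p.1 := by
    refine (summable_prod_of_nonneg fun p => mul_nonneg (G.nonneg _ _) (he _).1).2 ⟨fun x => ?_, ?_⟩
    · exact (G.summable x).mul_right (e x)
    · exact hs.congr fun x => (tsum_mul_right (f := G.b x) (a := e x)).symm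
  have hF : Summable fun p : V × V => (e p.1 : ℂ) * ((G.b p.1 p.2 : ℂ) * w p.1 p.2) := by
    -- Absolute summability over pairs permits summing in either order; here `e² ≤ e` because `0 ≤ e
    -- ≤ 1`.
    refine Summable.of_norm_bounded (hE.add hbe) fun p => ?_
    refine (norm_mul_mul_le (G.nonneg p.1 p.2) (e p.1) (w p.1 p.2) one_pos).trans ?_
    rw [one_mul, inv_one, one_mul]
    refine add_le_add_right (mul_le_mul_of_nonneg_left ?_ (G.nonneg _ _)) _
    rw [sq]
    exact mul_le_of_le_one_right (he _).1 (he _).2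
  have h1 : ∑' x, (e x : ℂ) * G.divergence w x =
      ∑' p : V × V, (e p.1 : ℂ) * ((G.b p.1 p.2 : ℂ) * w p.1 p.2) := by
    rw [hF.tsum_prod]
    exact tsum_congr fun x => tsum_mul_left.symm
  have hF' := (Equiv.prodComm V V).summable_iff.2 hF
  have h2 := (Equiv.prodComm V V).tsum_eq
    fun p : V × V => (e p.1 : ℂ) * ((G.b p.1 p.2 : ℂ) * w p.1 p.2)
  rw [two_mul, h1]
  nth_rw 2 [← h2]
  refine (hF.tsum_add hF').symm.trans (tsum_congr fun p => ?_)
  simp only [Function.comp_apply, Equiv.prodComm_apply, Prod.fst_swap, Prod.snd_swap]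
  rw [hw, G.symm p.2 p.1]
  push_cast
  ring

/-- On a connected recurrent graph the divergence of a flow of finite energy has total mass zero
if it is summable. -/
theorem IsRecurrent.tsum_divergence_eq_zero (hG : G.IsRecurrent)
    (hc : G.toSimpleGraph.Preconnected) {w : V → V → ℂ} (hw : ∀ x y, w y x = -w x y)
    (hE : Summable fun p : V × V => G.b p.1 p.2 * ‖w p.1 p.2‖ ^ 2)
    (hd : Summable fun x => ‖G.divergence w x‖) : ∑' x, G.divergence w x = 0 := by
  obtain ⟨e, he, hs, hes, hlim, hone⟩ := hG.exists_tendsto_one G hc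
  have hconv : Filter.Tendsto (fun n => 2 * ∑' x, (e n x : ℂ) * G.divergence w x) Filter.atTop
      (nhds (2 * ∑' x, G.divergence w x)) := by
    refine (tendsto_tsum_of_dominated_convergence hd (fun x => ?_)
      (Filter.Eventually.of_forall fun n x => ?_)).const_mul 2
    · have := (Complex.continuous_ofReal.tendsto 1).comp (hone x)
      simpa using this.mul_const (G.divergence w x)
    · rw [norm_mul, Complex.norm_real, Real.norm_of_nonneg (he n x).1]
      exact mul_le_of_le_one_left (norm_nonneg _) (he n x).2
  set E := ∑' p : V × V, G.b p.1 p.2 * ‖w p.1 p.2‖ ^ 2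
  -- With `t` fixed, the term with `t⁻¹` disappears as `n → ∞` because the energy of `e n` vanishes;
  -- only afterwards does `t` tend to `0`.
  have hbound : ∀ t : ℝ, 0 < t → ‖2 * ∑' x, G.divergence w x‖ ≤ t * E := fun t ht => by
    have h1 : Filter.Tendsto (fun n => t * E +
        t⁻¹ * ∑' p : V × V, G.b p.1 p.2 * (e n p.1 - e n p.2) ^ 2) Filter.atTop
        (nhds (t * E)) := by
      simpa using (hlim.const_mul t⁻¹).const_add (t * E)
    refine le_of_tendsto_of_tendsto hconv.norm h1 (Filter.Eventually.of_forall fun n => ?_)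
    dsimp only
    rw [two_mul_tsum_mul_divergence hw hE (he n) (hs n)]
    exact tsum_of_norm_bounded ((hE.hasSum.mul_left t).add ((hes n).hasSum.mul_left t⁻¹))
      fun p => norm_mul_mul_le (G.nonneg _ _) _ _ ht
  have h0 : ‖2 * ∑' x, G.divergence w x‖ ≤ 0 := by
    have h1 : Filter.Tendsto (fun t : ℝ => t * E) (nhdsWithin 0 (Set.Ioi 0)) (nhds 0) := by
      have : Filter.Tendsto (fun t : ℝ => t * E) (nhds 0) (nhds (0 * E)) :=
        Filter.tendsto_id.mul_const E
      rw [zero_mul] at this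
      exact this.mono_left nhdsWithin_le_nhds
    exact ge_of_tendsto h1 (Filter.eventually_of_mem self_mem_nhdsWithin hbound)
  exact (mul_eq_zero.1 (norm_le_zero_iff.1 h0)).resolve_left two_ne_zero

theorem adj_of_b_ne_zero {x y : V} (h : G.b x y ≠ 0) : G.toSimpleGraph.Adj x y :=
  lt_of_le_of_ne (G.nonneg x y) h.symm

theorem preconnected_induce_supp (C : G.toSimpleGraph.ConnectedComponent) :
    (G.induce C.supp).toSimpleGraph.Preconnected :=
  C.connected_toSimpleGraph.preconnected

theorem b_eq_zero_of_notMem_supp (C : G.toSimpleGraph.ConnectedComponent) {x y : V}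
    (hx : x ∈ C.supp) (hy : y ∉ C.supp) : G.b x y = 0 := by
  by_contra h
  exact hy ((C.mem_supp_congr_adj (adj_of_b_ne_zero h)).1 hx)

theorem divergence_induce_supp (C : G.toSimpleGraph.ConnectedComponent) (w : V → V → ℂ)
    (x : C.supp) :
    (G.induce C.supp).divergence (fun y z => w y z) x = G.divergence w x := by
  refine tsum_subtype_eq_of_support_subset (f := fun y => (G.b x y : ℂ) * w x y) fun y hy => ?_
  by_contra h
  exact hy (by simp [b_eq_zero_of_notMem_supp C x.2 h])

/-- No edge joins different components, so the divergence is computed inside each one and the total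
splits over components. -/
theorem tsum_divergence_eq_zero_of_forall_isRecurrent
    (hG : ∀ C : G.toSimpleGraph.ConnectedComponent, (G.induce C.supp).IsRecurrent)
    {w : V → V → ℂ} (hw : ∀ x y, w y x = -w x y)
    (hE : Summable fun p : V × V => G.b p.1 p.2 * ‖w p.1 p.2‖ ^ 2)
    (hd : Summable fun x => ‖G.divergence w x‖) : ∑' x, G.divergence w x = 0 := by
  let φ := Equiv.sigmaFiberEquiv G.toSimpleGraph.connectedComponentMk
  have hs : Summable fun q => G.divergence w (φ q) := φ.summable_iff.2 hd.of_norm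
  rw [← φ.tsum_eq, hs.tsum_sigma]
  refine (tsum_congr fun C => ?_).trans tsum_zero
  have h := (hG C).tsum_divergence_eq_zero (preconnected_induce_supp C)
    (w := fun y z => w y z) (fun x y => hw x y)
    (hE.comp_injective (i := Prod.map Subtype.val Subtype.val)
      (Subtype.val_injective.prodMap Subtype.val_injective))
    ((hd.comp_injective Subtype.val_injective).congr fun x => by
      rw [divergence_induce_supp]; rfl)
  simp_rw [divergence_induce_supp] at h
  exact h

/-- If a connected component is not recurrent, there is a function of finite energy whose Laplacian
is a nonzero multiple of the indicator function of a vertex. -/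
theorem exists_potential_of_not_forall_isRecurrent
    (hG : ¬∀ C : G.toSimpleGraph.ConnectedComponent, (G.induce C.supp).IsRecurrent) :
    ∃ (f : V → ℝ) (o : V) (a : ℝ), a ≠ 0 ∧
      (Summable fun p : V × V => G.b p.1 p.2 * (f p.1 - f p.2) ^ 2) ∧
      ∀ x, ∑' y, G.b x y * (f x - f y) = ({o} : Set V).indicator (fun _ => a) x := by
  classical
  push Not at hG
  obtain ⟨C, hC⟩ := hG
  obtain ⟨f, o, ho, hE, hf⟩ := (G.induce C.supp).exists_potential_of_not_isRecurrent hC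
    (preconnected_induce_supp C)
  -- Extension by zero creates no energy and no Laplacian, since no edge leaves the component.
  set F : V → ℝ := fun x => if h : x ∈ C.supp then f ⟨x, h⟩ else 0
  have hFin : ∀ x : C.supp, F x = f x := fun x => dif_pos x.2
  have hFout : ∀ x, x ∉ C.supp → F x = 0 := fun x hx => dif_neg hx
  refine ⟨F, o, (G.induce C.supp).deg o, ho.ne', ?_, fun x => ?_⟩
  · have hinj : Function.Injective (Prod.map Subtype.val Subtype.val : C.supp × C.supp → V × V) :=
      Subtype.val_injective.prodMap Subtype.val_injective
    refine (hinj.summable_iff fun p hp => ?_).1 (hE.congr fun p => ?_)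
    · by_cases h1 : p.1 ∈ C.supp
      · have h2 : p.2 ∉ C.supp := fun h2 => hp ⟨(⟨p.1, h1⟩, ⟨p.2, h2⟩), rfl⟩
        rw [b_eq_zero_of_notMem_supp C h1 h2, zero_mul]
      · by_cases h2 : p.2 ∈ C.supp
        · rw [G.symm, b_eq_zero_of_notMem_supp C h2 h1, zero_mul]
        · simp [hFout _ h1, hFout _ h2]
    · simp only [Function.comp, Prod.map_fst, Prod.map_snd, hFin]
      rfl
  · by_cases hx : x ∈ C.supp
    · have h1 := hf ⟨x, hx⟩
      have h2 : ∑' y : C.supp, G.b x y * (F x - F y) = ∑' y, G.b x y * (F x - F y) :=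
        tsum_subtype_eq_of_support_subset (f := fun y => G.b x y * (F x - F y)) fun y hy => by
          by_contra h
          exact hy (by simp [b_eq_zero_of_notMem_supp C hx h])
      rw [← h2]
      refine (tsum_congr fun y => ?_).trans (h1.trans ?_)
      · rw [hFin y, ← hFin ⟨x, hx⟩]; rfl
      · by_cases hxo : x = o
        · subst hxo; simp
        · have : (⟨x, hx⟩ : C.supp) ≠ o := fun h => hxo (congrArg Subtype.val h)
          simp [hxo, this]
    · have hxo : x ≠ o := fun h => hx (h ▸ o.2)
      have h0 : ∀ y, G.b x y * (F x - F y) = 0 := fun y => by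
        by_cases hy : y ∈ C.supp
        · rw [G.symm, b_eq_zero_of_notMem_supp C hy hx, zero_mul]
        · rw [hFout x hx, hFout y hy, sub_zero, mul_zero]
      simp [h0, hxo]

end WeightedGraph

/-! ### Cofaces of `ρ` and of its cofaces in terms of the link -/

theorem IsFace.card_eq {X : Type*} [DecidableEq X] {τ σ : Finset X} (h : IsFace τ σ) :
    σ.card = τ.card + 1 := by
  rw [← Finset.card_sdiff_add_card_eq_card h.1, h.2, add_comm]

theorem isFace_of_subset_of_card {X : Type*} [DecidableEq X] {τ σ : Finset X} (h : τ ⊆ σ)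
    (hc : σ.card = τ.card + 1) : IsFace τ σ :=
  ⟨h, by rw [Finset.card_sdiff_of_subset h, hc, Nat.add_sub_cancel_left]⟩

theorem IsFace.exists_eq_insert {X : Type*} [DecidableEq X] {τ σ : Finset X} (h : IsFace τ σ) :
    ∃ v, v ∉ τ ∧ σ = insert v τ := by
  obtain ⟨v, hv⟩ := Finset.card_eq_one.1 h.2
  refine ⟨v, fun hvτ => ?_, ?_⟩
  · have : v ∈ σ \ τ := hv ▸ Finset.mem_singleton_self v
    exact (Finset.mem_sdiff.1 this).2 hvτ
  · rw [← Finset.sdiff_union_of_subset h.1, hv, Finset.insert_eq]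

namespace WeightedComplex

theorem m_cell_pos {X : Type*} {K : WeightedComplex X} (σ : K.Cell) : 0 < K.m σ :=
  K.m_pos _ σ.2.1

variable {X : Type*} [DecidableEq X] {K : WeightedComplex X}

/-- The coface `v ∪ ρ` of `ρ` given by a vertex `v` of the link. -/
def cone (ρ : K.Cell) (v : K.link ρ) : K.Cell := ⟨insert v.1 ρ.1, insert_mem_cells v.2.2.1⟩

theorem isFace_cone (ρ : K.Cell) (v : K.link ρ) : IsFace ρ.1 (cone ρ v).1 := v.2.2.2

theorem cone_injective (ρ : K.Cell) : Function.Injective (cone ρ) := fun v w h => by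
  have h1 : insert v.1 ρ.1 = insert w.1 ρ.1 := congrArg Subtype.val h
  have h2 : v.1 ∈ insert w.1 ρ.1 := h1 ▸ Finset.mem_insert_self _ _
  exact Subtype.ext ((Finset.mem_insert.1 h2).resolve_right (not_mem_of_mem_link v.2))

theorem exists_cone_eq {ρ τ : K.Cell} (h : IsFace ρ.1 τ.1) : ∃ v, cone ρ v = τ := by
  obtain ⟨v, hv, hτ⟩ := h.exists_eq_insert
  have hτf : insert v ρ.1 ∈ K.faces := hτ ▸ τ.2.1
  refine ⟨⟨v, K.down_closed hτf ?_, hτf, hτ ▸ h⟩, Subtype.ext hτ.symm⟩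
  exact Finset.singleton_subset_iff.2 (Finset.mem_insert_self _ _)

/-- The cofaces of `ρ` correspond to the vertices of the link. -/
noncomputable def coneEquiv (ρ : K.Cell) : K.link ρ ≃ {τ : K.Cell // IsFace ρ.1 τ.1} :=
  Equiv.ofBijective (fun v => ⟨cone ρ v, isFace_cone ρ v⟩)
    ⟨fun _ _ h => cone_injective ρ (congrArg Subtype.val h), fun τ => by
      obtain ⟨v, hv⟩ := exists_cone_eq τ.2
      exact ⟨v, Subtype.ext hv⟩⟩

theorem coe_coneEquiv (ρ : K.Cell) (v : K.link ρ) : (coneEquiv ρ v : K.Cell) = cone ρ v := rfl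

/-- Adjacency in the link graph. -/
def LinkAdj (ρ : K.Cell) (v w : K.link ρ) : Prop :=
  v ≠ w ∧ insert v.1 (insert w.1 ρ.1) ∈ K.faces

theorem LinkAdj.symm {ρ : K.Cell} {v w : K.link ρ} (h : LinkAdj ρ v w) : LinkAdj ρ w v :=
  ⟨h.1.symm, by rw [Finset.insert_comm]; exact h.2⟩

open Classical in
/-- The simplex `{v, w} ∪ ρ` for adjacent vertices `v, w` of the link. -/
noncomputable def join (ρ : K.Cell) (v w : K.link ρ) : K.Cell :=
  if h : insert v.1 (insert w.1 ρ.1) ∈ K.faces then ⟨_, insert_mem_cells h⟩ else ρ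

theorem coe_join {ρ : K.Cell} {v w : K.link ρ} (h : LinkAdj ρ v w) :
    (join ρ v w).1 = insert v.1 (insert w.1 ρ.1) := by
  rw [join, dif_pos h.2]

theorem LinkAdj.join_comm {ρ : K.Cell} {v w : K.link ρ} (h : LinkAdj ρ v w) :
    join ρ v w = join ρ w v :=
  Subtype.ext (by rw [coe_join h, coe_join h.symm, Finset.insert_comm])

theorem LinkAdj.notMem_cone {ρ : K.Cell} {v w : K.link ρ} (h : LinkAdj ρ v w) :
    w.1 ∉ (cone ρ v).1 := fun hw => by
  rcases Finset.mem_insert.1 hw with h1 | h1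
  · exact h.1 (Subtype.ext h1.symm)
  · exact not_mem_of_mem_link w.2 h1

theorem LinkAdj.coe_join_eq_insert {ρ : K.Cell} {v w : K.link ρ} (h : LinkAdj ρ v w) :
    (join ρ v w).1 = insert w.1 (cone ρ v).1 := by
  rw [coe_join h, Finset.insert_comm]
  rfl

theorem LinkAdj.isFace_cone_join {ρ : K.Cell} {v w : K.link ρ} (h : LinkAdj ρ v w) :
    IsFace (cone ρ v).1 (join ρ v w).1 := by
  rw [h.coe_join_eq_insert]
  exact isFace_insert h.notMem_cone

theorem LinkAdj.card_join {ρ : K.Cell} {v w : K.link ρ} (h : LinkAdj ρ v w) :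
    (join ρ v w).1.card = ρ.1.card + 2 := by
  rw [h.isFace_cone_join.card_eq, (isFace_cone ρ v).card_eq]

theorem LinkAdj.subset_join {ρ : K.Cell} {v w : K.link ρ} (h : LinkAdj ρ v w) :
    ρ.1 ⊆ (join ρ v w).1 :=
  (isFace_cone ρ v).1.trans h.isFace_cone_join.1

open Classical in
theorem linkWeight_eq (ρ : K.Cell) (v w : K.link ρ) :
    K.linkWeight ρ v w = if LinkAdj ρ v w then K.m (join ρ v w) else 0 := by
  unfold linkWeight
  refine if_ctx_congr Iff.rfl (fun h => ?_) fun _ => rfl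
  rw [coe_join h]

/-- The cofaces of `v ∪ ρ` correspond to the neighbours of `v` in the link graph. -/
noncomputable def joinEquiv (ρ : K.Cell) (v : K.link ρ) :
    {w | LinkAdj ρ v w} ≃ {σ : K.Cell // IsFace (cone ρ v).1 σ.1} :=
  Equiv.ofBijective (fun w => ⟨join ρ v w, LinkAdj.isFace_cone_join w.2⟩) <| by
    constructor
    · intro w w' h
      have h1 : (join ρ v w).1 = (join ρ v w').1 := congrArg (fun σ => σ.1.1) h
      rw [LinkAdj.coe_join_eq_insert w.2, LinkAdj.coe_join_eq_insert w'.2] at h1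
      have h2 : w.1.1 ∈ insert w'.1.1 (cone ρ v).1 := h1 ▸ Finset.mem_insert_self _ _
      exact Subtype.ext (Subtype.ext
        ((Finset.mem_insert.1 h2).resolve_right (LinkAdj.notMem_cone w.2)))
    · rintro ⟨σ, hσ⟩
      obtain ⟨w, hw, hσw⟩ := hσ.exists_eq_insert
      have hwρ : w ∉ ρ.1 := fun h => hw ((isFace_cone ρ v).1 h)
      have hwf : insert w ρ.1 ∈ K.faces :=
        K.down_closed (hσw ▸ σ.2.1) (Finset.insert_subset_insert _ (isFace_cone ρ v).1)
      let w' : K.link ρ := ⟨w, K.down_closed hwf (Finset.singleton_subset_iff.2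
        (Finset.mem_insert_self _ _)), hwf, isFace_insert hwρ⟩
      have hadj : LinkAdj ρ v w' := by
        refine ⟨fun h => hw ?_, ?_⟩
        · rw [h]; exact Finset.mem_insert_self _ _
        · rw [Finset.insert_comm]
          have := σ.2.1
          rwa [hσw] at this
      exact ⟨⟨w', hadj⟩, Subtype.ext (Subtype.ext (hadj.coe_join_eq_insert.trans hσw.symm))⟩

open Classical in
theorem tsum_coface_cone (ρ : K.Cell) (v : K.link ρ) (F : K.Cell → ℂ) :
    ∑' σ : {σ : K.Cell // IsFace (cone ρ v).1 σ.1}, F σ =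
      ∑' w, if LinkAdj ρ v w then F (join ρ v w) else 0 := by
  rw [← (joinEquiv ρ v).tsum_eq]
  exact tsum_subtype {w | LinkAdj ρ v w} fun w => F (join ρ v w)

/-! ### The flow on the link graph induced by `ω` -/

namespace Coboundary

variable (δ : K.Coboundary)

theorem θ_eq_zero {τ σ : K.Cell} (h : ¬IsFace τ.1 σ.1) : δ.θ τ σ = 0 := by
  by_contra h0
  exact h ((δ.ne_zero_iff τ σ).1 h0)

theorem θ_mul_self {τ σ : K.Cell} (h : IsFace τ.1 σ.1) : δ.θ τ σ * δ.θ τ σ = 1 := by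
  have h0 : δ.θ τ σ ≠ 0 := (δ.ne_zero_iff τ σ).2 h
  rcases δ.sign τ σ with h1 | h1 | h1
  · rw [θ, h1, one_mul]
  · rw [θ, h1]; norm_num
  · exact absurd h1 h0

theorem norm_θ {τ σ : K.Cell} (h : IsFace τ.1 σ.1) : ‖δ.θ τ σ‖ = 1 := by
  have h1 := congrArg norm (δ.θ_mul_self h)
  rw [norm_mul, norm_one] at h1
  nlinarith [norm_nonneg (δ.θ τ σ)]

/-- Among the faces of `vwρ` only `vρ` and `wρ` contain `ρ`; `η` vanishes on all others. -/
theorem op_join {ρ : K.Cell} {η : K.Cell → ℂ} (hη : ∀ τ : K.Cell, ¬IsFace ρ.1 τ.1 → η τ = 0)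
    {v w : K.link ρ} (h : LinkAdj ρ v w) :
    δ.op η (join ρ v w) = δ.θ (cone ρ v) (join ρ v w) * η (cone ρ v) +
      δ.θ (cone ρ w) (join ρ v w) * η (cone ρ w) := by
  classical
  have hne : cone ρ v ≠ cone ρ w := fun h1 => h.1 (cone_injective ρ h1)
  rw [δ.apply_eq, finsum_mem_eq_sum_of_inter_support_eq (t := {cone ρ v, cone ρ w}),
    Finset.sum_pair hne]
  · rfl
  ext τ
  simp only [Set.mem_inter_iff, Set.mem_ofPred_eq, Function.mem_support, Finset.coe_insert,
    Finset.coe_singleton, Set.mem_insert_iff, Set.mem_singleton_iff]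
  refine and_congr_left fun h0 => ⟨fun hτ => ?_, ?_⟩
  · have hρτ : IsFace ρ.1 τ.1 := by
      by_contra h1
      exact h0 (by rw [hη τ h1, mul_zero])
    obtain ⟨u, rfl⟩ := exists_cone_eq hρτ
    have hu : u.1 ∈ (join ρ v w).1 := hτ.1 (Finset.mem_insert_self _ _)
    rw [coe_join h, Finset.mem_insert, Finset.mem_insert] at hu
    rcases hu with hu | hu | hu
    · exact Or.inl (congrArg (cone ρ) (Subtype.ext hu))
    · exact Or.inr (congrArg (cone ρ) (Subtype.ext hu))
    · exact absurd hu (not_mem_of_mem_link u.2)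
  · rintro (rfl | rfl)
    · exact h.isFace_cone_join
    · rw [h.join_comm]
      exact h.symm.isFace_cone_join

/-- This is `δδ1_ρ(vwρ) = 0`; it is what turns `ω` into an antisymmetric flow. -/
theorem θ_antisymm {ρ : K.Cell} {v w : K.link ρ} (h : LinkAdj ρ v w) :
    δ.θ ρ (cone ρ w) * δ.θ (cone ρ w) (join ρ v w) =
      -(δ.θ ρ (cone ρ v) * δ.θ (cone ρ v) (join ρ v w)) := by
  have h1 := δ.op_join (η := δ.op (Pi.single ρ 1)) (fun τ hτ => δ.θ_eq_zero hτ) h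
  rw [δ.op_op, Pi.zero_apply] at h1
  change 0 = _ * δ.θ ρ (cone ρ v) + _ * δ.θ ρ (cone ρ w) at h1
  linear_combination -h1

open Classical in
/-- The flow on the link graph induced by a function on the simplices, per edge weight. -/
noncomputable def linkFlow (ω : K.Cell → ℂ) (ρ : K.Cell) (v w : K.link ρ) : ℂ :=
  if LinkAdj ρ v w then δ.θ ρ (cone ρ v) * δ.θ (cone ρ v) (join ρ v w) * ω (join ρ v w) else 0

theorem linkFlow_antisymm (ω : K.Cell → ℂ) (ρ : K.Cell) (v w : K.link ρ) :
    δ.linkFlow ω ρ w v = -δ.linkFlow ω ρ v w := by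
  unfold linkFlow
  by_cases h : LinkAdj ρ v w
  · rw [if_pos h, if_pos h.symm, ← h.join_comm, δ.θ_antisymm h, neg_mul]
  · rw [if_neg h, if_neg fun h' => h h'.symm, neg_zero]

theorem norm_linkFlow {ω : K.Cell → ℂ} {ρ : K.Cell} {v w : K.link ρ} (h : LinkAdj ρ v w) :
    ‖δ.linkFlow ω ρ v w‖ = ‖ω (join ρ v w)‖ := by
  rw [linkFlow, if_pos h, norm_mul, norm_mul, δ.norm_θ (isFace_cone ρ v),
    δ.norm_θ h.isFace_cone_join, one_mul, one_mul]

theorem divergence_linkFlow (hK : K.LocallySummable) (ω : K.Cell → ℂ) (ρ : K.Cell)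
    (v : K.link ρ) : (K.linkGraph hK ρ).divergence (δ.linkFlow ω ρ) v =
      (K.m (cone ρ v) : ℂ) * δ.θ ρ (cone ρ v) * δ.boundary ω (cone ρ v) := by
  classical
  have hm : (K.m (cone ρ v) : ℂ) ≠ 0 := Complex.ofReal_ne_zero.2 (m_cell_pos _).ne'
  unfold boundary
  rw [tsum_coface_cone ρ v fun σ => (K.m σ : ℂ) * δ.θ (cone ρ v) σ * ω σ,
    show ∀ s : ℂ, (K.m (cone ρ v) : ℂ) * δ.θ ρ (cone ρ v) * (1 / (K.m (cone ρ v) : ℂ) * s) =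
      δ.θ ρ (cone ρ v) * s from fun s => by field_simp, ← tsum_mul_left]
  refine tsum_congr fun w => ?_
  change (K.linkWeight ρ v w : ℂ) * _ = _
  rw [linkWeight_eq, linkFlow]
  split_ifs
  · ring
  · simp

theorem boundary_boundary_eq (hK : K.LocallySummable) (ω : K.Cell → ℂ) (ρ : K.Cell) :
    δ.boundary (δ.boundary ω) ρ =
      1 / (K.m ρ : ℂ) * ∑' v, (K.linkGraph hK ρ).divergence (δ.linkFlow ω ρ) v := by
  rw [boundary, ← (coneEquiv ρ).tsum_eq]
  simp_rw [coe_coneEquiv, ← δ.divergence_linkFlow hK]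

theorem summable_norm_divergence_iff (hK : K.LocallySummable) (ω : K.Cell → ℂ) (ρ : K.Cell) :
    (Summable fun v => ‖(K.linkGraph hK ρ).divergence (δ.linkFlow ω ρ) v‖) ↔
      Summable fun τ : {τ : K.Cell // IsFace ρ.1 τ.1} => K.m τ.1 * ‖δ.boundary ω τ.1‖ := by
  rw [← (coneEquiv ρ).summable_iff]
  refine summable_congr fun v => ?_
  rw [δ.divergence_linkFlow, norm_mul, norm_mul, δ.norm_θ (isFace_cone ρ v), mul_one,
    Complex.norm_real, Real.norm_of_nonneg (m_cell_pos _).le]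
  rfl

theorem norm_boundary_le {ω : K.Cell → ℂ} (hω : ω ∈ K.boundaryDomain) (τ : K.Cell) :
    K.m τ * ‖δ.boundary ω τ‖ ≤ ∑' σ : {σ : K.Cell // IsFace τ.1 σ.1}, K.m σ.1 * ‖ω σ.1‖ := by
  have hm := m_cell_pos τ
  have h1 : ∀ σ : {σ : K.Cell // IsFace τ.1 σ.1},
      ‖(K.m σ.1 : ℂ) * δ.θ τ σ.1 * ω σ.1‖ = K.m σ.1 * ‖ω σ.1‖ := fun σ => by
    rw [norm_mul, norm_mul, δ.norm_θ σ.2, mul_one, Complex.norm_real,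
      Real.norm_of_nonneg (m_cell_pos _).le]
  rw [boundary, norm_mul, ← mul_assoc, norm_div, norm_one, Complex.norm_real,
    Real.norm_of_nonneg hm.le, mul_one_div_cancel hm.ne', one_mul]
  refine (norm_tsum_le_tsum_norm ((hω τ).congr fun σ => (h1 σ).symm)).trans_eq ?_
  exact tsum_congr h1

/-- An edge `(v, w)` is determined by the simplex `σ = vwρ` together with `v ∈ σ`. So each `σ` is
counted at most `|ρ| + 2` times, and the energy is at most `|ρ| + 2` times the squared `ℓ²` norm. -/
theorem summable_energy_linkFlow (hK : K.LocallySummable) {ω : K.Cell → ℂ} (hω : ω ∈ K.ell2)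
    (ρ : K.Cell) : Summable fun p : K.link ρ × K.link ρ =>
      (K.linkGraph hK ρ).b p.1 p.2 * ‖δ.linkFlow ω ρ p.1 p.2‖ ^ 2 := by
  classical
  let F : (Σ σ : K.Cell, {v // v ∈ σ.1}) → ℝ := fun q =>
    if q.1.1.card = ρ.1.card + 2 then K.m q.1 * ‖ω q.1‖ ^ 2 else 0
  have hF0 : ∀ q, 0 ≤ F q := fun q => by
    dsimp only [F]
    split_ifs
    · exact mul_nonneg (m_cell_pos _).le (sq_nonneg _)
    · exact le_rfl
  have hF : Summable F := by
    refine (summable_sigma_of_nonneg hF0).2 ⟨fun σ => Summable.of_finite, ?_⟩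
    refine Summable.of_nonneg_of_le (fun σ => tsum_nonneg fun v => hF0 _) (fun σ => ?_)
      (hω.mul_left ((ρ.1.card + 2 : ℕ) : ℝ))
    rw [tsum_fintype]
    simp only [F, Finset.sum_const, Finset.card_univ, Fintype.card_coe, nsmul_eq_mul]
    split_ifs with h
    · rw [h]
    · rw [mul_zero]
      exact mul_nonneg (Nat.cast_nonneg _) (mul_nonneg (m_cell_pos _).le (sq_nonneg _))
  let s : Set (K.link ρ × K.link ρ) := {p | LinkAdj ρ p.1 p.2}
  let φ : s → Σ σ : K.Cell, {v // v ∈ σ.1} := fun p =>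
    ⟨join ρ p.1.1 p.1.2, p.1.1.1, (LinkAdj.isFace_cone_join p.2).1 (Finset.mem_insert_self _ _)⟩
  have hφ : Function.Injective φ := by
    rintro ⟨⟨v, w⟩, h : LinkAdj ρ v w⟩ ⟨⟨v', w'⟩, h' : LinkAdj ρ v' w'⟩ heq
    have h1 : join ρ v w = join ρ v' w' := congrArg Sigma.fst heq
    have h2 : v.1 = v'.1 := congrArg (fun q : Σ σ : K.Cell, {v // v ∈ σ.1} => q.2.1) heq
    obtain rfl : v = v' := Subtype.ext h2
    have h3 : w.1 ∈ insert w'.1 (cone ρ v).1 := by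
      rw [← h'.coe_join_eq_insert, ← h1, h.coe_join_eq_insert]
      exact Finset.mem_insert_self _ _
    obtain rfl : w = w' :=
      Subtype.ext ((Finset.mem_insert.1 h3).resolve_right h.notMem_cone)
    rfl
  have h1 : Summable ((fun p : K.link ρ × K.link ρ =>
      K.m (join ρ p.1 p.2) * ‖ω (join ρ p.1 p.2)‖ ^ 2) ∘ ((↑) : s → _)) :=
    (hF.comp_injective hφ).congr fun p => if_pos (LinkAdj.card_join p.2)
  refine (summable_subtype_iff_indicator.1 h1).congr fun p => ?_
  change _ = K.linkWeight ρ p.1 p.2 * _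
  rw [linkWeight_eq]
  by_cases h : LinkAdj ρ p.1 p.2
  · rw [Set.indicator_of_mem (show p ∈ s from h), if_pos h, δ.norm_linkFlow h]
  · rw [Set.indicator_of_notMem (show p ∉ s from h), if_neg h, zero_mul]

/-- A function on the simplices with prescribed gradient flow on the link graph of `ρ`, vanishing
on all simplices not of the form `{v, w} ∪ ρ`. -/
theorem exists_linkFlow_eq_sub (ρ : K.Cell) (f : K.link ρ → ℝ) :
    ∃ ω : K.Cell → ℂ, (∀ v w, LinkAdj ρ v w → δ.linkFlow ω ρ v w = ((f v - f w : ℝ) : ℂ)) ∧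
      ∀ σ, ω σ ≠ 0 → ∃ v w, LinkAdj ρ v w ∧ join ρ v w = σ := by
  classical
  -- The potential `f` is carried to the cofaces of `ρ` with sign `θ(ρ, vρ)`; by `θ_antisymm` the
  -- signs in `linkFlow` then turn `δη(vwρ)` into `f v - f w`.
  let η : K.Cell → ℂ := fun τ =>
    if h : IsFace ρ.1 τ.1 then δ.θ ρ τ * f ((coneEquiv ρ).symm ⟨τ, h⟩) else 0
  have hη0 : ∀ τ : K.Cell, ¬IsFace ρ.1 τ.1 → η τ = 0 := fun τ hτ => dif_neg hτ
  have hη : ∀ v, η (cone ρ v) = δ.θ ρ (cone ρ v) * f v := fun v => by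
    have : (coneEquiv ρ).symm ⟨cone ρ v, isFace_cone ρ v⟩ = v := (coneEquiv ρ).symm_apply_apply v
    simp only [η]
    rw [dif_pos (isFace_cone ρ v), this]
  -- `δη` already vanishes off these simplices; cutting off by hand makes the support claim
  -- immediate.
  refine ⟨fun σ => if ∃ v w, LinkAdj ρ v w ∧ join ρ v w = σ then δ.op η σ else 0,
    fun v w h => ?_, fun σ hσ => ?_⟩
  · have h1 := δ.θ_mul_self (isFace_cone ρ v)
    have h2 := δ.θ_mul_self h.isFace_cone_join
    have h3 := δ.θ_antisymm h
    rw [linkFlow, if_pos h, if_pos ⟨v, w, h, rfl⟩, δ.op_join hη0 h, hη, hη]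
    push_cast
    generalize δ.θ ρ (cone ρ v) = a at *
    generalize δ.θ (cone ρ v) (join ρ v w) = b at *
    linear_combination (f v : ℂ) * (b * b * h1 + h2) + a * b * (f w : ℂ) * h3 -
      (f w : ℂ) * (b * b * h1 + h2)
  · by_contra h
    exact hσ (if_neg h)

end Coboundary

/-! ### Membership in the domains of `∂` and `∂∂` -/

theorem ell2_subset_boundaryDomain (hK : K.LocallySummable) : K.ell2 ⊆ K.boundaryDomain := by
  intro ω hω ρ
  have h : Summable fun τ : {τ : K.Cell // IsFace ρ.1 τ.1} => K.m τ.1 * ‖ω τ.1‖ ^ 2 :=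
    hω.comp_injective Subtype.val_injective
  refine Summable.of_nonneg_of_le
    (fun τ => mul_nonneg (m_cell_pos _).le (norm_nonneg _)) (fun τ => ?_) ((hK ρ).add h)
  -- The bound is `|ω| ≤ 1 + |ω|²`; the constant `1` is summable against `m` by local summability.
  rw [← mul_one_add]
  refine mul_le_mul_of_nonneg_left ?_ (m_cell_pos _).le
  nlinarith [sq_nonneg (‖ω τ.1‖ - 1), sq_nonneg ‖ω τ.1‖]

/-- Only the empty simplex can be discarded, and a set that is not a simplex has no cofaces. -/
theorem summable_coface_of_nonempty {ω : K.Cell → ℂ} (hω : ω ∈ K.boundaryDomain) {A : Finset X}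
    (hA : A.Nonempty) :
    Summable fun σ : {σ : K.Cell // IsFace A σ.1} => K.m σ.1 * ‖ω σ.1‖ := by
  by_cases h : A ∈ K.faces
  · exact hω ⟨A, h, fun h0 => absurd h0 hA.ne_empty⟩
  · have : IsEmpty {σ : K.Cell // IsFace A σ.1} :=
      ⟨fun σ => h (K.down_closed σ.1.2.1 σ.2.1)⟩
    exact summable_empty

theorem sigma_coface_ext {ρ : K.Cell}
    {q q' : Σ τ : {τ : K.Cell // IsFace ρ.1 τ.1}, {σ : K.Cell // IsFace τ.1.1 σ.1}}
    (h1 : q.1.1 = q'.1.1) (h2 : q.2.1 = q'.2.1) : q = q' := by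
  obtain ⟨⟨τ, hτ⟩, ⟨σ, hσ⟩⟩ := q
  obtain ⟨⟨τ', hτ'⟩, ⟨σ', hσ'⟩⟩ := q'
  obtain rfl : τ = τ' := h1
  obtain rfl : σ = σ' := h2
  rfl

/-- If `ω` lives on the simplices with two more vertices than `ρ` that contain `ρ`, then for
`∂ω ∈ D(∂)` only the cofaces of `ρ` matter. -/
theorem boundary_mem_boundaryDomain (δ : K.Coboundary) {ω : K.Cell → ℂ}
    (hω : ω ∈ K.boundaryDomain) {ρ : K.Cell}
    (hsupp : ∀ σ, ω σ ≠ 0 → ρ.1 ⊆ σ.1 ∧ σ.1.card = ρ.1.card + 2)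
    (hρ : Summable fun τ : {τ : K.Cell // IsFace ρ.1 τ.1} => K.m τ.1 * ‖δ.boundary ω τ.1‖) :
    δ.boundary ω ∈ K.boundaryDomain := by
  classical
  intro ρ'
  by_cases hne : ρ' = ρ
  · rw [hne]; exact hρ
  let S := Σ τ : {τ : K.Cell // IsFace ρ'.1 τ.1}, {σ : K.Cell // IsFace τ.1.1 σ.1}
  -- At `ρ' ≠ ρ` no cancellation is needed: the double sum over `τ ≻ ρ'` and `σ ≻ τ` converges
  -- absolutely.
  have hS : Summable fun q : S => K.m q.2.1 * ‖ω q.2.1‖ := by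
    let s : Set S := {q | ω q.2.1 ≠ 0}
    suffices h : Summable ((fun q : S => K.m q.2.1 * ‖ω q.2.1‖) ∘ ((↑) : s → S)) by
      refine (summable_subtype_iff_indicator.1 h).congr fun q => ?_
      by_cases hq : ω q.2.1 = 0 <;> simp [s, hq]
    -- If `ρ' ⊆ ρ`, any `σ` in the support above `ρ'` has both `|ρ'| + 2` and `|ρ| + 2` vertices,
    -- which forces `ρ' = ρ`.
    by_cases hsub : ρ'.1 ⊆ ρ.1
    · have : IsEmpty s := ⟨fun q => hne (Subtype.ext (Finset.eq_of_subset_of_card_le hsub ?_))⟩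
      · exact summable_empty
      have h1 := (hsupp _ q.2).2
      rw [q.1.2.2.card_eq, q.1.1.2.card_eq] at h1
      omega
    -- Otherwise every such `σ` contains both `ρ` and `u`, hence is a coface of `A = ρ ∪ {u}`. It is
    -- counted once for each admissible `τ ⊆ σ`, at most `2 ^ (|A| + 1)` times, and `ω ∈ D(∂)` gives
    -- summability over the cofaces of `A`.
    obtain ⟨u, huρ', huρ⟩ := Finset.not_subset.1 hsub
    set A := insert u ρ.1
    have hAc : A.card = ρ.1.card + 1 := Finset.card_insert_of_notMem huρ
    have hAσ : ∀ q : s, IsFace A q.1.2.1.1 := fun q => by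
      refine isFace_of_subset_of_card (Finset.insert_subset ?_ (hsupp _ q.2).1) ?_
      · exact q.1.2.2.1 (q.1.1.2.1 huρ')
      · rw [(hsupp _ q.2).2, hAc]
    let T := Σ σ : {σ : K.Cell // IsFace A σ.1}, {t // t ∈ σ.1.1.powerset}
    have hT : Summable fun q : T => K.m q.1.1 * ‖ω q.1.1‖ := by
      refine (summable_sigma_of_nonneg
        fun q => mul_nonneg (m_cell_pos _).le (norm_nonneg _)).2 ⟨fun σ => Summable.of_finite, ?_⟩
      refine ((summable_coface_of_nonempty hω (Finset.insert_nonempty u ρ.1)).mul_left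
        ((2 ^ (A.card + 1) : ℕ) : ℝ)).congr fun σ => ?_
      rw [tsum_fintype]
      dsimp only
      rw [Finset.sum_const, Finset.card_univ, Fintype.card_coe, Finset.card_powerset, σ.2.card_eq,
        nsmul_eq_mul]
    let φ : s → T := fun q =>
      ⟨⟨q.1.2.1, hAσ q⟩, q.1.1.1.1, Finset.mem_powerset.2 q.1.2.2.1⟩
    have hφ : Function.Injective φ := by
      intro q q' heq
      have h1 : q.1.2.1 = q'.1.2.1 := congrArg (fun t : T => t.1.1) heq
      have h2 : q.1.1.1 = q'.1.1.1 := Subtype.ext (congrArg (fun t : T => t.2.1) heq)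
      exact Subtype.ext (sigma_coface_ext h2 h1)
    exact (hT.comp_injective hφ).congr fun _ => rfl
  exact Summable.of_nonneg_of_le (fun τ => mul_nonneg (m_cell_pos _).le (norm_nonneg _))
    (fun τ => δ.norm_boundary_le hω τ.1) hS.sigma

end WeightedComplex

/-! ### The equivalence -/

theorem mainTheorem1 {X : Type*} [DecidableEq X] (K : WeightedComplex X)
    (hK : K.LocallySummable) (δ : K.Coboundary) (ρ : K.Cell) :
    (∀ ω ∈ K.boundaryBoundaryDomain δ ∩ K.ell2, δ.boundary (δ.boundary ω) ρ = 0) ↔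
      ∀ C : (K.linkGraph hK ρ).toSimpleGraph.ConnectedComponent,
        ((K.linkGraph hK ρ).induce C.supp).IsRecurrent := by
  classical
  constructor
  · intro h
    by_contra hG
    obtain ⟨f, o, a, ha, hE, hf⟩ :=
      WeightedGraph.exists_potential_of_not_forall_isRecurrent hG
    obtain ⟨ω, hω, hsupp⟩ := δ.exists_linkFlow_eq_sub ρ f
    have hdiv : ∀ v, (K.linkGraph hK ρ).divergence (δ.linkFlow ω ρ) v =
        ((({o} : Set (K.link ρ)).indicator (fun _ => a) v : ℝ) : ℂ) := fun v => by
      rw [← hf v, Complex.ofReal_tsum]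
      refine tsum_congr fun w => ?_
      by_cases hvw : WeightedComplex.LinkAdj ρ v w
      · rw [hω v w hvw, Complex.ofReal_mul]
      · have h0 : (K.linkGraph hK ρ).b v w = 0 :=
          (WeightedComplex.linkWeight_eq ρ v w).trans (if_neg hvw)
        rw [h0, zero_mul, Complex.ofReal_zero, zero_mul]
    -- Choosing one edge for each simplex in the support injects the `ℓ²` sum into the energy sum of
    -- `f`.
    have hell : ω ∈ K.ell2 := by
      let s : Set K.Cell := {σ | ω σ ≠ 0}
      choose φ ψ hφ hφψ using fun σ : s => hsupp σ.1 σ.2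
      have hinj : Function.Injective fun σ : s => (φ σ, ψ σ) := fun σ σ' hσ => by
        obtain ⟨h1, h2⟩ := Prod.mk.inj hσ
        exact Subtype.ext (by rw [← hφψ σ, ← hφψ σ', h1, h2])
      have hs : Summable ((fun σ : K.Cell => K.m σ * ‖ω σ‖ ^ 2) ∘ ((↑) : s → K.Cell)) := by
        refine (hE.comp_injective hinj).congr fun σ => ?_
        have h1 : (K.linkGraph hK ρ).b (φ σ) (ψ σ) = K.m σ.1 := by
          refine (WeightedComplex.linkWeight_eq ρ _ _).trans ?_
          rw [if_pos (hφ σ), hφψ]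
        have h2 := δ.norm_linkFlow (ω := ω) (hφ σ)
        rw [hω _ _ (hφ σ), hφψ, Complex.norm_real, Real.norm_eq_abs] at h2
        simp only [Function.comp_apply]
        rw [h1, ← h2, sq_abs]
      refine (summable_subtype_iff_indicator.1 hs).congr fun σ => ?_
      by_cases hσ : ω σ = 0 <;> simp [s, hσ]
    have hdom := WeightedComplex.ell2_subset_boundaryDomain hK hell
    have hbd : δ.boundary ω ∈ K.boundaryDomain := by
      refine WeightedComplex.boundary_mem_boundaryDomain δ hdom (ρ := ρ) (fun σ hσ => ?_)
        ((δ.summable_norm_divergence_iff hK ω ρ).1 ?_)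
      · obtain ⟨v, w, hvw, rfl⟩ := hsupp σ hσ
        exact ⟨hvw.subset_join, hvw.card_join⟩
      · refine summable_of_ne_finset_zero (s := {o}) fun v hv => ?_
        rw [hdiv, Set.indicator_of_notMem (by simpa using hv)]
        simp
    have h1 := h ω ⟨⟨hdom, hbd⟩, hell⟩
    -- The total divergence is `a`, so `∂∂ω(ρ) = a / m(ρ) ≠ 0`.
    rw [δ.boundary_boundary_eq hK, tsum_eq_single o fun v hv => by simp [hdiv, hv]] at h1
    simp [hdiv, ha, (WeightedComplex.m_cell_pos ρ).ne'] at h1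
  · rintro hG ω ⟨⟨_, hbd⟩, hell⟩
    rw [δ.boundary_boundary_eq hK,
      WeightedGraph.tsum_divergence_eq_zero_of_forall_isRecurrent hG (δ.linkFlow_antisymm ω ρ)
        (δ.summable_energy_linkFlow hK hell ρ)
        ((δ.summable_norm_divergence_iff hK ω ρ).2 (hbd ρ)), mul_zero]
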